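/- **Setting.** All vector spaces are over $\mathbb C$. A Lie conformal algebra is a $\mathbb C[\partial]$-module $R$ with a $\mathbb C$-linear $\lambda$-bracket $R\otimes R\to\mathbb C[\lambda]\otimes R$, $a\otimes b\mapsto[a\,{}_\lambda\,b]$, such that $[\partial a\,{}_\lambda\,b]=-\lambda[a\,{}_\lambda\,b]$, $[a\,{}_\lambda\,\partial b]=(\partial+\lambda)[a\,{}_\lambda\,b]$, $[a\,{}_\lambda\,b]=-[b\,{}_{-\lambda-\partial}\,a]$ and $[a\,{}_\lambda[b\,{}_\mu\,c]]=[[a\,{}_\lambda\,b]\,{}_{\lambda+\mu}\,c]+[b\,{}_\mu[a\,{}_\lambda\,c]]$. A conformal module over $R$ is a $\mathbb C[\partial]$-module $M$ with a $\mathbb C$-linear $\lambda$-action $R\otimes M\to\mathbb C[\lambda]\otimes M$ such that $(\partial a)\,{}_\lambda\,v=-\lambda\,a\,{}_\lambda\,v$, $a\,{}_\lambda(\partial v)=(\partial+\lambda)\,a\,{}_\lambda\,v$ and $[a\,{}_\lambda\,b]\,{}_{\lambda+\mu}\,v=a\,{}_\lambda(b\,{}_\mu\,v)-b\,{}_\mu(a\,{}_\lambda\,v)$.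 It is *finite* (resp. *free of rank one*) if it is so as a $\mathbb C[\partial]$-module, *nontrivial* if its $\lambda$-action is not identically zero, and *irreducible* if it is nonzero and its only submodules are $0$ and itself; a submodule is a $\mathbb C[\partial]$-submodule $S$ with $a\,{}_\lambda\,v\in\mathbb C[\lambda]\otimes S$ for all $a\in R$, $v\in S$. For $p\in\mathbb C$ let $\mathcal B(p)$ be the Lie conformal algebra with $\mathbb C[\partial]$-basis $\{L_i\mid i\ge 0\}$ and $$[L_i\,{}_\lambda\,L_j]=((i+p)\partial+(i+j+2p)\lambda)L_{i+j},$$ and let $\mathcal B(p)_{\langle m\rangle}=\bigoplus_{i\ge m}\mathbb C[\partial]L_i$, an ideal. For $n\ge1$ let $\mathfrak b(n)=\mathcal B(-n)/\mathcal B(-n)_{\langle n+1\rangle}$, with $\mathbb C[\partial]$-basis the classes $\bar L_0,\dots,\bar L_n$. For $n\ge1$ and $\Delta,\alpha\in\mathbb C$ let $M_{\Delta,\alpha}=\mathbb C[\partial]v$ be the conformal $\mathfrak b(n)$-module, free of rank one, with $$\bar L_0\,{}_\lambda\,v=-n(\partial+\Delta\lambda+\alpha)v,\qquad \bar L_i\,{}_\lambda\,v=0\quad(1\le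 i\le n).$$ For $\Delta,\alpha,\beta\in\mathbb C$ let $M_{\Delta,\alpha,\beta}=\mathbb C[\partial]v$ be the conformal $\mathfrak b(1)$-module, free of rank one, with $$\bar L_0\,{}_\lambda\,v=-(\partial+\Delta\lambda+\alpha)v,\qquad \bar L_1\,{}_\lambda\,v=\beta v.$$ **Corollary 5.3.** (1) Let $n>1$. A conformal $\mathfrak b(n)$-module $M$ is nontrivial and free of rank one if and only if $M\cong M_{\Delta,\alpha}$ for some $\Delta,\alpha\in\mathbb C$. (2) A conformal $\mathfrak b(1)$-module $M$ is nontrivial and free of rank one if and only if $M\cong M_{\Delta,\alpha,\beta}$ for some $\Delta,\alpha,\beta\in\mathbb C$. (3) For $n\ge 1$, the $\mathfrak b(n)$-module $M_{\Delta,\alpha}$ is irreducible if and only if $\Delta\ne0$. The $\mathfrak b(1)$-module $M_{\Delta,\alpha,\beta}$ is irreducible if and only if $\Delta\ne0$ or $\beta\ne0$. (4) For $n\ge 1$ and $\alpha\in\mathbb C$, the $\mathfrak b(n)$-module $M_{0,\alpha}$ has exactly one nonzero proper submodule, namely $(\partial+\alpha)M_{0,\alpha}$, and it is isomorphic to $M_{1,\alpha}$.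 The $\mathfrak b(1)$-module $M_{0,\alpha,0}$ has exactly one nonzero proper submodule, namely $(\partial+\alpha)M_{0,\alpha,0}$, and it is isomorphic to $M_{1,\alpha,0}$. (5) Let $n>1$. A conformal $\mathfrak b(n)$-module $M$ is finite, irreducible and nontrivial if and only if $M\cong M_{\Delta,\alpha}$ for some $\Delta,\alpha\in\mathbb C$ with $\Delta\ne0$. A conformal $\mathfrak b(1)$-module $M$ is finite, irreducible and nontrivial if and only if $M\cong M_{\Delta,\alpha,\beta}$ for some $\Delta,\alpha,\beta\in\mathbb C$ with $\Delta\ne0$ or $\beta\ne0$. -/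

import Mathlib

open Polynomial

noncomputable section

namespace LieConf

universe u v w

/-! Throughout, `ℂ[X]` is the ring `ℂ[∂]`, the indeterminate `X` being `∂`. A `ℂ[∂]`-module `M`
is also regarded as a complex vector space, compatibly (`IsScalarTower ℂ ℂ[X] M`). -/

/-- `ℂ[λ] ⊗ M`: polynomials in `λ` with coefficients in `M`; the value at `k` is the coefficient
of `λ ^ k`. -/
abbrev LamPoly (M : Type u) [AddCommGroup M] : Type u := ℕ →₀ M

section Eval

variable {M : Type u} [AddCommGroup M] [Module ℂ M] [Module ℂ[X] M] [IsScalarTower ℂ ℂ[X] M]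
variable {N : Type v} [AddCommGroup N] [Module ℂ N] [Module ℂ[X] N] [IsScalarTower ℂ ℂ[X] N]

/-- Substitution `λ := q` for `q ∈ ℂ[∂]`: it maps `∑ λ ^ k m_k` to `∑ q ^ k • m_k`.
The polynomial `q = C z` gives the value at the complex number `z`, and `q = -C z - X` is the
substitution `λ := -z - ∂`. -/
def lamEval (q : ℂ[X]) : LamPoly M →ₗ[ℂ] M :=
  Finsupp.lsum ℂ fun k => Algebra.lsmul ℂ ℂ M (q ^ k)

lemma lamEval_apply (q : ℂ[X]) (P : LamPoly M) :
    lamEval q P = P.sum fun k m => q ^ k • m := rfl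

lemma lamEval_mapRange (f : M →ₗ[ℂ[X]] N) (q : ℂ[X]) (P : LamPoly M) :
    lamEval q (P.mapRange f (map_zero f)) = f (lamEval q P) := by
  rw [lamEval_apply, lamEval_apply, Finsupp.sum_mapRange_index (by simp)]
  simp [Finsupp.sum, map_sum]

end Eval

section Defn

variable (R : Type u) [AddCommGroup R] [Module ℂ R] [Module ℂ[X] R] [IsScalarTower ℂ ℂ[X] R]

/-- Lie conformal algebra structures on the `ℂ[∂]`-module `R`. The axioms are identities between
polynomials in `λ` (and `μ`) with coefficients in `R`; as `ℂ` is infinite, they are expressed by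
the values at all complex numbers `l`, `m`. -/
structure LieConformalAlgebra where
  /-- the `λ`-bracket `a ⊗ b ↦ [a _λ b]` -/
  bracket : R →ₗ[ℂ] R →ₗ[ℂ] LamPoly R
  sesq_left : ∀ (l : ℂ) (a b : R),
    lamEval (C l) (bracket ((X : ℂ[X]) • a) b) = -(l • lamEval (C l) (bracket a b))
  sesq_right : ∀ (l : ℂ) (a b : R),
    lamEval (C l) (bracket a ((X : ℂ[X]) • b)) = (X + C l) • lamEval (C l) (bracket a b)
  skew : ∀ (l : ℂ) (a b : R),
    lamEval (C l) (bracket a b) = -lamEval (-C l - X) (bracket b a)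
  jacobi : ∀ (l m : ℂ) (a b c : R),
    lamEval (C l) (bracket a (lamEval (C m) (bracket b c))) =
      lamEval (C (l + m)) (bracket (lamEval (C l) (bracket a b)) c) +
        lamEval (C m) (bracket b (lamEval (C l) (bracket a c)))

variable {R}

/-- Conformal module structures on the `ℂ[∂]`-module `M` over the Lie conformal algebra `A`. -/
structure ConformalModule (A : LieConformalAlgebra R)
    (M : Type v) [AddCommGroup M] [Module ℂ M] [Module ℂ[X] M] [IsScalarTower ℂ ℂ[X] M] where
  /-- the `λ`-action `a ⊗ v ↦ a _λ v` -/
  act : R →ₗ[ℂ] M →ₗ[ℂ] LamPoly M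
  sesq_left : ∀ (l : ℂ) (a : R) (v : M),
    lamEval (C l) (act ((X : ℂ[X]) • a) v) = -(l • lamEval (C l) (act a v))
  sesq_right : ∀ (l : ℂ) (a : R) (v : M),
    lamEval (C l) (act a ((X : ℂ[X]) • v)) = (X + C l) • lamEval (C l) (act a v)
  jacobi : ∀ (l m : ℂ) (a b : R) (v : M),
    lamEval (C (l + m)) (act (lamEval (C l) (A.bracket a b)) v) =
      lamEval (C l) (act a (lamEval (C m) (act b v))) -
        lamEval (C m) (act b (lamEval (C l) (act a v)))

namespace ConformalModule

variable {A : LieConformalAlgebra R}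
variable {M : Type v} [AddCommGroup M] [Module ℂ M] [Module ℂ[X] M] [IsScalarTower ℂ ℂ[X] M]
variable {N : Type w} [AddCommGroup N] [Module ℂ N] [Module ℂ[X] N] [IsScalarTower ℂ ℂ[X] N]

/-- The module is nontrivial: the `λ`-action is not identically zero. -/
def IsNontrivial (ρ : ConformalModule A M) : Prop := ∃ a v, ρ.act a v ≠ 0

/-- The `ℂ[∂]`-submodule `S` is a conformal submodule: `a _λ v ∈ ℂ[λ] ⊗ S` for `v ∈ S`. -/
def IsConformalSubmodule (ρ : ConformalModule A M) (S : Submodule ℂ[X] M) : Prop :=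
  ∀ a, ∀ v ∈ S, ∀ k, ρ.act a v k ∈ S

/-- The module is nonzero, and its only conformal submodules are `0` and itself. -/
def IsIrreducible (ρ : ConformalModule A M) : Prop :=
  Nontrivial M ∧ ∀ S, ρ.IsConformalSubmodule S → S = ⊥ ∨ S = ⊤

/-- Isomorphism of conformal modules. -/
def Iso (ρ : ConformalModule A M) (σ : ConformalModule A N) : Prop :=
  ∃ e : M ≃ₗ[ℂ[X]] N, ∀ a v, σ.act a (e v) = (ρ.act a v).mapRange e (map_zero e)

/-- The action on a conformal submodule, as a bilinear map. -/
def restrictAct (ρ : ConformalModule A M) (S : Submodule ℂ[X] M)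
    (h : ρ.IsConformalSubmodule S) : R →ₗ[ℂ] S →ₗ[ℂ] LamPoly S :=
  LinearMap.mk₂ ℂ
    (fun a v => Finsupp.onFinset (ρ.act a v).support (fun k => ⟨ρ.act a v k, h a v v.2 k⟩)
      (fun k hk => by
        rw [Finsupp.mem_support_iff]
        exact fun h0 => hk (Subtype.ext h0)))
    (fun a b v => by ext k; simp)
    (fun c a v => by ext k; simp)
    (fun a v w => by ext k; simp)
    (fun c a v => by ext k; simp)

lemma mapRange_restrictAct (ρ : ConformalModule A M) (S : Submodule ℂ[X] M)
    (h : ρ.IsConformalSubmodule S) (a : R) (v : S) :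
    (ρ.restrictAct S h a v).mapRange S.subtype (map_zero S.subtype) = ρ.act a v := by
  ext k; simp [restrictAct]

lemma coe_lamEval_restrictAct (ρ : ConformalModule A M) (S : Submodule ℂ[X] M)
    (h : ρ.IsConformalSubmodule S) (q : ℂ[X]) (a : R) (v : S) :
    ((lamEval q (ρ.restrictAct S h a v) : S) : M) = lamEval q (ρ.act a v) := by
  rw [← mapRange_restrictAct ρ S h, lamEval_mapRange]; rfl

/-- A conformal submodule is a conformal module. -/
def restrict (ρ : ConformalModule A M) (S : Submodule ℂ[X] M)
    (h : ρ.IsConformalSubmodule S) : ConformalModule A S where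
  act := ρ.restrictAct S h
  sesq_left l a v := Subtype.ext <| by
    simpa [coe_lamEval_restrictAct] using ρ.sesq_left l a v
  sesq_right l a v := Subtype.ext <| by
    simpa [coe_lamEval_restrictAct] using ρ.sesq_right l a v
  jacobi l m a b v := Subtype.ext <| by
    simpa only [coe_lamEval_restrictAct, Submodule.coe_sub] using ρ.jacobi l m a b v

end ConformalModule

end Defn

section Quotient

variable {R : Type u} [AddCommGroup R] [Module ℂ R] [Module ℂ[X] R] [IsScalarTower ℂ ℂ[X] R]
variable {M : Type v} [AddCommGroup M] [Module ℂ M] [Module ℂ[X] M] [IsScalarTower ℂ ℂ[X] M]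

/-- `I` is a (two-sided) ideal of the Lie conformal algebra `A`. -/
def LieConformalAlgebra.IsIdeal (A : LieConformalAlgebra R) (I : Submodule ℂ[X] R) : Prop :=
  ∀ a, ∀ b ∈ I, ∀ k, A.bracket a b k ∈ I ∧ A.bracket b a k ∈ I

/-- Descent of a `ℂ`-linear map to the quotient by a `ℂ[∂]`-submodule. -/
def liftC {W : Type w} [AddCommGroup W] [Module ℂ W] (I : Submodule ℂ[X] R) (f : R →ₗ[ℂ] W)
    (h : ∀ a ∈ I, f a = 0) : (R ⧸ I) →ₗ[ℂ] W :=
  ((I.restrictScalars ℂ).liftQ f (fun a ha => h a ha)) ∘ₗ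
    (Submodule.Quotient.restrictScalarsEquiv ℂ I).symm.toLinearMap

lemma liftC_mk {W : Type w} [AddCommGroup W] [Module ℂ W] (I : Submodule ℂ[X] R)
    (f : R →ₗ[ℂ] W) (h : ∀ a ∈ I, f a = 0) (a : R) : liftC I f h (I.mkQ a) = f a := rfl

/-- Reduction of the coefficients modulo `I`. -/
def redMod (I : Submodule ℂ[X] R) : LamPoly R →ₗ[ℂ] LamPoly (R ⧸ I) :=
  Finsupp.mapRange.linearMap (I.mkQ.restrictScalars ℂ)

lemma lamEval_redMod (I : Submodule ℂ[X] R) (q : ℂ[X]) (P : LamPoly R) :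
    lamEval q (redMod I P) = I.mkQ (lamEval q P) := lamEval_mapRange I.mkQ q P

lemma redMod_eq_zero (I : Submodule ℂ[X] R) (P : LamPoly R) (h : ∀ k, P k ∈ I) :
    redMod I P = 0 := by
  ext k
  simpa [redMod] using h k

/-- The `λ`-bracket of the quotient `A / I`:
`[a + I _λ b + I]` is the reduction of `[a _λ b]` modulo `I`. -/
def LieConformalAlgebra.quotientBracket (A : LieConformalAlgebra R) (I : Submodule ℂ[X] R)
    (hI : A.IsIdeal I) : (R ⧸ I) →ₗ[ℂ] (R ⧸ I) →ₗ[ℂ] LamPoly (R ⧸ I) :=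
  liftC I
    (LinearMap.flip (liftC I (LinearMap.flip (A.bracket.compr₂ (redMod I)))
      (fun b hb => LinearMap.ext fun a => redMod_eq_zero I _ fun k => (hI a b hb k).1)))
    (fun a ha => LinearMap.ext fun b => by
      obtain ⟨b, rfl⟩ := I.mkQ_surjective b
      exact redMod_eq_zero I _ fun k => (hI b a ha k).2)

lemma LieConformalAlgebra.quotientBracket_mk (A : LieConformalAlgebra R) (I : Submodule ℂ[X] R)
    (hI : A.IsIdeal I) (a b : R) :
    A.quotientBracket I hI (I.mkQ a) (I.mkQ b) = redMod I (A.bracket a b) := rfl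

lemma LieConformalAlgebra.lamEval_quotientBracket (A : LieConformalAlgebra R)
    (I : Submodule ℂ[X] R) (hI : A.IsIdeal I) (q : ℂ[X]) (a b : R) :
    lamEval q (A.quotientBracket I hI (I.mkQ a) (I.mkQ b)) =
      I.mkQ (lamEval q (A.bracket a b)) := by
  rw [quotientBracket_mk, lamEval_redMod]

/-- The quotient of a Lie conformal algebra by an ideal. -/
def LieConformalAlgebra.quotient (A : LieConformalAlgebra R) (I : Submodule ℂ[X] R)
    (hI : A.IsIdeal I) : LieConformalAlgebra (R ⧸ I) where
  bracket := A.quotientBracket I hI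
  sesq_left l a b := by
    obtain ⟨a, rfl⟩ := I.mkQ_surjective a
    obtain ⟨b, rfl⟩ := I.mkQ_surjective b
    rw [← map_smul, A.lamEval_quotientBracket, A.lamEval_quotientBracket, A.sesq_left, map_neg]
    rfl
  sesq_right l a b := by
    obtain ⟨a, rfl⟩ := I.mkQ_surjective a
    obtain ⟨b, rfl⟩ := I.mkQ_surjective b
    rw [← map_smul, A.lamEval_quotientBracket, A.lamEval_quotientBracket, A.sesq_right, map_smul]
  skew l a b := by
    obtain ⟨a, rfl⟩ := I.mkQ_surjective a
    obtain ⟨b, rfl⟩ := I.mkQ_surjective b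
    rw [A.lamEval_quotientBracket, A.lamEval_quotientBracket, A.skew, map_neg]
  jacobi l m a b c := by
    obtain ⟨a, rfl⟩ := I.mkQ_surjective a
    obtain ⟨b, rfl⟩ := I.mkQ_surjective b
    obtain ⟨c, rfl⟩ := I.mkQ_surjective c
    simp only [A.lamEval_quotientBracket]
    rw [A.jacobi, map_add]

/-- A conformal module on which the ideal `I` acts trivially, as a module over the quotient. -/
def ConformalModule.descend {A : LieConformalAlgebra R} (ρ : ConformalModule A M)
    (I : Submodule ℂ[X] R) (hI : A.IsIdeal I) (h : ∀ a ∈ I, ρ.act a = 0) :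
    ConformalModule (A.quotient I hI) M where
  act := liftC I ρ.act h
  sesq_left l a v := by
    obtain ⟨a, rfl⟩ := I.mkQ_surjective a
    exact ρ.sesq_left l a v
  sesq_right l a v := by
    obtain ⟨a, rfl⟩ := I.mkQ_surjective a
    exact ρ.sesq_right l a v
  jacobi l m a b v := by
    obtain ⟨a, rfl⟩ := I.mkQ_surjective a
    obtain ⟨b, rfl⟩ := I.mkQ_surjective b
    have := ρ.jacobi l m a b v
    have e : lamEval (C l) ((A.quotient I hI).bracket (I.mkQ a) (I.mkQ b)) =
        I.mkQ (lamEval (C l) (A.bracket a b)) := A.lamEval_quotientBracket I hI _ a b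
    rw [e]
    exact this

end Quotient

section Block

/-- The coefficients, with respect to the outer variable `λ`, of an element of `ℂ[∂][λ]`. -/
def lamCoeffs : ℂ[X][X] →ₗ[ℂ] LamPoly ℂ[X] where
  toFun P := Finsupp.onFinset P.support P.coeff (fun k hk => mem_support_iff.2 hk)
  map_add' P Q := by ext k; simp
  map_smul' c P := by ext k; simp

lemma lamEval_lamCoeffs (q : ℂ[X]) (P : ℂ[X][X]) : lamEval q (lamCoeffs P) = P.eval q := by
  rw [lamEval_apply, eval_eq_sum, Polynomial.sum, lamCoeffs]
  simp only [LinearMap.coe_mk, AddHom.coe_mk]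
  rw [Finsupp.onFinset_sum _ (by simp)]
  exact Finset.sum_congr rfl fun k _ => by rw [smul_eq_mul, mul_comm]

/-- For fixed `φ ∈ ℂ[∂][λ]`, the bilinear map `(f, g) ↦ f(-λ) g(∂ + λ) φ(∂, λ)`. -/
def sesqExt (φ : ℂ[X][X]) : ℂ[X] →ₗ[ℂ] ℂ[X] →ₗ[ℂ] LamPoly ℂ[X] :=
  ((LinearMap.mul ℂ ℂ[X][X]).compl₁₂
    (aeval (-X : ℂ[X][X])).toLinearMap (aeval (C X + X : ℂ[X][X])).toLinearMap).compr₂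
    (lamCoeffs ∘ₗ LinearMap.mulRight ℂ φ)

lemma lamEval_sesqExt (φ : ℂ[X][X]) (q f g : ℂ[X]) :
    lamEval q (sesqExt φ f g) = f.comp (-q) * g.comp (X + q) * φ.eval q := by
  have h : ∀ (r : ℂ[X][X]) (f : ℂ[X]), (aeval r f).eval q = f.comp (r.eval q) := by
    intro r f
    rw [aeval_def, ← coe_evalRingHom, hom_eval₂, comp]
    congr 1
    ext x; simp
  simp [sesqExt, lamEval_lamCoeffs, h]

/-- The free `ℂ[∂]`-module with basis `L_0, L_1, L_2, …`. -/
abbrev BlockCarrier : Type := ℕ →₀ ℂ[X]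

/-- The basis element `L_i`. -/
def blockL (i : ℕ) : BlockCarrier := Finsupp.single i 1

/-- `(i + p) ∂ + (i + j + 2 p) λ` as an element of `ℂ[∂][λ]`. -/
def blockCoeff (p : ℂ) (i j : ℕ) : ℂ[X][X] :=
  C (C (i + p) * X) + C (C (i + j + 2 * p)) * X

/-- The sesquilinear extension of `[L_i _λ L_j] = ((i + p) ∂ + (i + j + 2 p) λ) L_{i + j}`, so
`[f(∂) L_i _λ g(∂) L_j] = f(-λ) g(∂ + λ) ((i + p) ∂ + (i + j + 2 p) λ) L_{i + j}`. -/
def blockBracket (p : ℂ) : BlockCarrier →ₗ[ℂ] BlockCarrier →ₗ[ℂ] LamPoly BlockCarrier :=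
  Finsupp.lsum ℂ fun i => LinearMap.flip <| Finsupp.lsum ℂ fun j => LinearMap.flip <|
    (sesqExt (blockCoeff p i j)).compr₂
      (Finsupp.mapRange.linearMap (Finsupp.lsingle (i + j)))

lemma blockBracket_single (p : ℂ) (i j : ℕ) (f g : ℂ[X]) :
    blockBracket p (Finsupp.single i f) (Finsupp.single j g) =
      (sesqExt (blockCoeff p i j) f g).mapRange (Finsupp.lsingle (R := ℂ[X]) (i + j))
        (map_zero _) := by
  simp only [blockBracket, Finsupp.lsum_single, LinearMap.flip_apply]
  rfl

lemma lamEval_blockBracket_single (p : ℂ) (q : ℂ[X]) (i j : ℕ) (f g : ℂ[X]) :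
    lamEval q (blockBracket p (Finsupp.single i f) (Finsupp.single j g)) =
      Finsupp.single (i + j) (f.comp (-q) * g.comp (X + q) *
        (C (i + p) * X + C (i + j + 2 * p) * q)) := by
  rw [blockBracket_single, lamEval_mapRange, lamEval_sesqExt]
  simp [blockCoeff]

/-- The Lie conformal algebra of Block type `𝓑(p)`. -/
def Block (p : ℂ) : LieConformalAlgebra BlockCarrier where
  bracket := blockBracket p
  sesq_left l a b := by
    induction a using Finsupp.induction_linear with
    | zero => simp
    | add a a' h h' => simp only [smul_add, map_add, LinearMap.add_apply, h, h', neg_add]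
    | single i f =>
      induction b using Finsupp.induction_linear with
      | zero => simp
      | add b b' h h' => simp only [smul_add, map_add, h, h', neg_add]
      | single j g =>
        rw [Finsupp.smul_single, lamEval_blockBracket_single, lamEval_blockBracket_single,
          Finsupp.smul_single, ← Finsupp.single_neg]
        congr 1
        simp [smul_eq_C_mul, mul_assoc]
  sesq_right l a b := by
    induction a using Finsupp.induction_linear with
    | zero => simp
    | add a a' h h' => simp only [smul_add, map_add, LinearMap.add_apply, h, h']
    | single i f =>
      induction b using Finsupp.induction_linear with
      | zero => simp
      | add b b' h h' => simp only [smul_add, map_add, h, h']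
      | single j g =>
        rw [Finsupp.smul_single, lamEval_blockBracket_single, lamEval_blockBracket_single,
          Finsupp.smul_single]
        congr 1
        simp only [smul_eq_mul, mul_comp, X_comp]
        ring
  skew l a b := by
    induction a using Finsupp.induction_linear with
    | zero => simp
    | add a a' h h' => simp only [map_add, LinearMap.add_apply, h, h', neg_add]
    | single i f =>
      induction b using Finsupp.induction_linear with
      | zero => simp
      | add b b' h h' => simp only [map_add, LinearMap.add_apply, h, h', neg_add]
      | single j g =>
        rw [lamEval_blockBracket_single, lamEval_blockBracket_single, add_comm j i,
          ← Finsupp.single_neg]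
        congr 1
        have h1 : -(-C l - X : ℂ[X]) = X + C l := by ring
        have h2 : (X + (-C l - X) : ℂ[X]) = -C l := by ring
        rw [h1, h2]
        simp only [map_add, two_mul]
        ring
  jacobi l m a b c := by
    induction a using Finsupp.induction_linear with
    | zero => simp
    | add a a' h h' => simp only [map_add, LinearMap.add_apply] at h h' ⊢; rw [h, h']; abel
    | single i f =>
      induction b using Finsupp.induction_linear with
      | zero => simp
      | add b b' h h' => simp only [map_add, LinearMap.add_apply] at h h' ⊢; rw [h, h']; abel
      | single j g =>
        induction c using Finsupp.induction_linear with
        | zero => simp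
        | add c c' h h' => simp only [map_add] at h h' ⊢; rw [h, h']; abel
        | single k h =>
          simp only [lamEval_blockBracket_single]
          rw [← add_assoc, add_left_comm j i k, ← add_assoc, ← Finsupp.single_add]
          congr 1
          have e1 : (g.comp (-C l + -C m + C l)) = g.comp (-C m) := by congr 1; ring
          have e2 : (g.comp (-C m)).comp (X + C l) = g.comp (-C m) := by
            rw [comp_assoc]; simp
          have e3 : (f.comp (-C l)).comp (X + C m) = f.comp (-C l) := by
            rw [comp_assoc]; simp
          have e4 : (h.comp (X + C m)).comp (X + C l) = h.comp (X + (C l + C m)) := by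
            rw [comp_assoc]; congr 1; simp; ring
          have e5 : (h.comp (X + C l)).comp (X + C m) = h.comp (X + (C l + C m)) := by
            rw [comp_assoc]; congr 1; simp; ring
          have e6 : (f.comp (-C l)).comp (-(C l + C m)) = f.comp (-C l) := by
            rw [comp_assoc]; simp
          have e7 : (g.comp (X + C l)).comp (-(C l + C m)) = g.comp (-C m) := by
            rw [comp_assoc]; congr 1; simp
          simp only [map_add, mul_comp, add_comp, C_comp, X_comp, e2, e3, e4, e5, e6,
            e7, Nat.cast_add, two_mul]
          ring

/-- `𝓑(p)_⟨m⟩ = ⊕_{i ≥ m} ℂ[∂] L_i`. -/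
def blockTail (m : ℕ) : Submodule ℂ[X] BlockCarrier := Finsupp.supported ℂ[X] ℂ[X] {i | m ≤ i}

lemma blockBracket_mem_tail (p : ℂ) (m : ℕ) (a b : BlockCarrier)
    (h : a ∈ blockTail m ∨ b ∈ blockTail m) (k : ℕ) : blockBracket p a b k ∈ blockTail m := by
  rw [← Finsupp.sum_single a, ← Finsupp.sum_single b, Finsupp.sum, Finsupp.sum]
  simp only [map_sum, LinearMap.sum_apply, Finsupp.finsetSum_apply]
  refine Submodule.sum_mem _ fun j hj => Submodule.sum_mem _ fun i hi => ?_
  rw [blockBracket_single, Finsupp.mapRange_apply]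
  refine Finsupp.single_mem_supported _ _ ?_
  rcases h with h | h
  · have := h hi
    simp only [Set.mem_ofPred_eq] at this ⊢
    omega
  · have := h hj
    simp only [Set.mem_ofPred_eq] at this ⊢
    omega

lemma blockTail_isIdeal (p : ℂ) (m : ℕ) : (Block p).IsIdeal (blockTail m) :=
  fun a b hb k => ⟨blockBracket_mem_tail p m a b (Or.inr hb) k,
    blockBracket_mem_tail p m b a (Or.inl hb) k⟩

/-- The Lie conformal algebra `𝔟(n) = 𝓑(-n) / 𝓑(-n)_⟨n+1⟩`. -/
def b (n : ℕ) : LieConformalAlgebra (BlockCarrier ⧸ blockTail (n + 1)) :=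
  (Block (-n)).quotient (blockTail (n + 1)) (blockTail_isIdeal _ _)

/-- The basis element `L̄_i` (`0 ≤ i ≤ n`) of `𝔟(n)`. -/
def bL (n i : ℕ) : BlockCarrier ⧸ blockTail (n + 1) := (blockTail (n + 1)).mkQ (blockL i)

lemma lamEval_b_bracket (n i j : ℕ) (q : ℂ[X]) :
    lamEval q ((b n).bracket (bL n i) (bL n j)) =
      (C ((i : ℂ) - n) * X + C ((i : ℂ) + j - 2 * n) * q) • bL n (i + j) := by
  refine (LieConformalAlgebra.lamEval_quotientBracket _ _ (blockTail_isIdeal _ _)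
    q (blockL i) (blockL j)).trans ?_
  rw [bL, ← map_smul]
  simp only [Block, blockL, lamEval_blockBracket_single, Finsupp.smul_single]
  congr 2
  simp [sub_eq_add_neg]

lemma bL_eq_zero (n i : ℕ) (h : n < i) : bL n i = 0 :=
  (Submodule.Quotient.mk_eq_zero _).2 (Finsupp.single_mem_supported _ _ h)

/-- The elements `p (∂ + Δ λ + α)`, `β`, `0`, `0`, … of `ℂ[∂][λ]`, giving the action of
`L_0`, `L_1`, `L_2`, `L_3`, … on the generator `v` of a free module of rank one. -/
def rankOneCoeff (p Δ α β : ℂ) : ℕ → ℂ[X][X]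
  | 0 => C (C p) * (C X + C (C Δ) * X + C (C α))
  | 1 => C (C β)
  | _ + 2 => 0

/-- The sesquilinear extension of `L_i _λ v = rankOneCoeff p Δ α β i` to `ℂ[∂] v = ℂ[∂]`. -/
def rankOneAct (p Δ α β : ℂ) : BlockCarrier →ₗ[ℂ] ℂ[X] →ₗ[ℂ] LamPoly ℂ[X] :=
  Finsupp.lsum ℂ fun i => sesqExt (rankOneCoeff p Δ α β i)

lemma lamEval_rankOneAct_single (p Δ α β : ℂ) (q : ℂ[X]) (i : ℕ) (f g : ℂ[X]) :
    lamEval q (rankOneAct p Δ α β (Finsupp.single i f) g) =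
      f.comp (-q) * g.comp (X + q) * (rankOneCoeff p Δ α β i).eval q := by
  rw [rankOneAct, Finsupp.lsum_single, lamEval_sesqExt]

/-- The conformal `𝓑(p)`-module `ℂ[∂] v` with `L_0 _λ v = p (∂ + Δ λ + α) v`, `L_1 _λ v = β v`
and `L_i _λ v = 0` for `i ≥ 2`; it exists for `β = 0` and for `p = -1`. -/
def blockRankOne (p Δ α β : ℂ) (hβ : β = 0 ∨ p = -1) : ConformalModule (Block p) ℂ[X] where
  act := rankOneAct p Δ α β
  sesq_left l a v := by
    induction a using Finsupp.induction_linear with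
    | zero => simp
    | add a a' h h' => simp only [smul_add, map_add, LinearMap.add_apply, h, h', neg_add]
    | single i f =>
      rw [Finsupp.smul_single, lamEval_rankOneAct_single, lamEval_rankOneAct_single]
      simp [smul_eq_C_mul, mul_assoc]
  sesq_right l a v := by
    induction a using Finsupp.induction_linear with
    | zero => simp
    | add a a' h h' => simp only [smul_add, map_add, LinearMap.add_apply, h, h']
    | single i f =>
      rw [lamEval_rankOneAct_single, lamEval_rankOneAct_single]
      simp only [smul_eq_mul, mul_comp, X_comp]
      ring
  jacobi l m a b v := by
    induction a using Finsupp.induction_linear with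
    | zero => simp
    | add a a' h h' => simp only [map_add, LinearMap.add_apply] at h h' ⊢; rw [h, h']; abel
    | single i f =>
      induction b using Finsupp.induction_linear with
      | zero => simp
      | add b b' h h' => simp only [map_add, LinearMap.add_apply] at h h' ⊢; rw [h, h']; abel
      | single j g =>
        have key : (C ((j + p) * l - (i + p) * m) : ℂ[X]) *
            (rankOneCoeff p Δ α β (i + j)).eval (C (l + m)) =
            ((rankOneCoeff p Δ α β j).eval (C m)).comp (X + C l) *
              (rankOneCoeff p Δ α β i).eval (C l) -
            ((rankOneCoeff p Δ α β i).eval (C l)).comp (X + C m) *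
              (rankOneCoeff p Δ α β j).eval (C m) := by
          have hb : (1 + C p : ℂ[X]) * C β = 0 := by
            rcases hβ with h | h <;> simp [h]
          match i, j with
          | 0, 0 => simp [rankOneCoeff]; ring
          | 0, 1 =>
            simp [rankOneCoeff]
            linear_combination C l * hb
          | 1, 0 =>
            simp [rankOneCoeff]
            linear_combination -C m * hb
          | 1, 1 => simp [rankOneCoeff, mul_comm]
          | i + 2, 0 => simp [rankOneCoeff]
          | i + 2, 1 => simp [rankOneCoeff]
          | i + 2, j + 2 =>
            have : i + 2 + (j + 2) = (i + j + 2) + 2 := by ring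
            rw [this]; simp [rankOneCoeff]
          | 0, j + 2 =>
            have : 0 + (j + 2) = j + 2 := by ring
            rw [this]; simp [rankOneCoeff]
          | 1, j + 2 =>
            have : 1 + (j + 2) = (j + 1) + 2 := by ring
            rw [this]; simp [rankOneCoeff]
        have e2 : (g.comp (-C m)).comp (X + C l) = g.comp (-C m) := by
          rw [comp_assoc]; simp
        have e3 : (f.comp (-C l)).comp (X + C m) = f.comp (-C l) := by
          rw [comp_assoc]; simp
        have e4 : (v.comp (X + C m)).comp (X + C l) = v.comp (X + C (l + m)) := by
          rw [comp_assoc]; congr 1; simp; ring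
        have e5 : (v.comp (X + C l)).comp (X + C m) = v.comp (X + C (l + m)) := by
          rw [comp_assoc]; congr 1; simp; ring
        have e6 : (f.comp (-C l)).comp (-C (l + m)) = f.comp (-C l) := by
          rw [comp_assoc]; simp
        have e7 : (g.comp (X + C l)).comp (-C (l + m)) = g.comp (-C m) := by
          rw [comp_assoc]; congr 1; simp
        have e8 : (C (i + p) * -C (l + m) + C (i + j + 2 * p) * C l : ℂ[X]) =
            C ((j + p) * l - (i + p) * m) := by
          simp only [map_add, map_mul, map_sub, two_mul]; ring
        simp only [Block, lamEval_blockBracket_single, lamEval_rankOneAct_single, mul_comp,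
          add_comp, C_comp, X_comp, e2, e3, e4, e5, e6, e7, e8]
        linear_combination (f.comp (-C l) * g.comp (-C m) * v.comp (X + C (l + m))) * key

lemma rankOneAct_tail (p Δ α β : ℂ) (m : ℕ) (h : ∀ i, m ≤ i → rankOneCoeff p Δ α β i = 0)
    (a : BlockCarrier) (ha : a ∈ blockTail m) : rankOneAct p Δ α β a = 0 := by
  rw [rankOneAct, Finsupp.lsum_apply, Finsupp.sum]
  refine Finset.sum_eq_zero fun i hi => ?_
  rw [h i (ha hi)]
  have h0 : sesqExt 0 = 0 := by
    refine LinearMap.ext fun f => LinearMap.ext fun g => ?_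
    simp [sesqExt]
  rw [h0, LinearMap.zero_apply]

/-- The conformal `𝔟(n)`-module `M_{Δ,α} = ℂ[∂] v` with `L̄_0 _λ v = -n (∂ + Δ λ + α) v` and
`L̄_i _λ v = 0` for `1 ≤ i ≤ n`. -/
def bM (n : ℕ) (Δ α : ℂ) : ConformalModule (b n) ℂ[X] :=
  (blockRankOne (-n) Δ α 0 (Or.inl rfl)).descend (blockTail (n + 1)) (blockTail_isIdeal _ _)
    (rankOneAct_tail _ _ _ _ _ fun i hi => by
      match i with
      | 0 => omega
      | 1 => simp [rankOneCoeff]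
      | i + 2 => rfl)

/-- The conformal `𝔟(1)`-module `M_{Δ,α,β} = ℂ[∂] v` with `L̄_0 _λ v = -(∂ + Δ λ + α) v` and
`L̄_1 _λ v = β v`. -/
def bMβ (Δ α β : ℂ) : ConformalModule (b 1) ℂ[X] :=
  (blockRankOne (-(1 : ℕ)) Δ α β (Or.inr (by simp))).descend (blockTail (1 + 1))
    (blockTail_isIdeal _ _)
    (rankOneAct_tail _ _ _ _ _ fun i hi => by
      match i with
      | 0 => omega
      | 1 => omega
      | i + 2 => rfl)

lemma lamEval_bM_act (n i : ℕ) (Δ α : ℂ) (q : ℂ[X]) :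
    lamEval q ((bM n Δ α).act (bL n i) 1) =
      if i = 0 then C (-(n : ℂ)) * (X + C Δ * q + C α) else 0 := by
  refine (lamEval_rankOneAct_single _ _ _ _ _ _ _ _).trans ?_
  match i with
  | 0 => simp [rankOneCoeff]
  | 1 => simp [rankOneCoeff]
  | i + 2 => simp [rankOneCoeff]

lemma lamEval_bMβ_act (i : ℕ) (Δ α β : ℂ) (q : ℂ[X]) :
    lamEval q ((bMβ Δ α β).act (bL 1 i) 1) =
      if i = 0 then -(X + C Δ * q + C α) else if i = 1 then C β else 0 := by
  refine (lamEval_rankOneAct_single _ _ _ _ _ _ _ _).trans ?_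
  match i with
  | 0 => simp [rankOneCoeff]
  | 1 => simp [rankOneCoeff]
  | i + 2 => simp [rankOneCoeff]

/-- The submodule `(∂ + α) ℂ[∂] v` of `ℂ[∂] v = ℂ[∂]`. -/
def shiftSubmodule (α : ℂ) : Submodule ℂ[X] ℂ[X] :=
  (⊤ : Submodule ℂ[X] ℂ[X]).map (LinearMap.lsmul ℂ[X] ℂ[X] (X + C α))

end Block

end LieConf

end

/-! Write L_{i,k} for the coefficient of λ^k in the action of L̄_i (`mode`). By `commutator_mode`
these operators satisfy the relations of the annihilation algebra: ad L_{0,1} is diagonal, L_{i,k}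
having weight i + n(k - 1), and L_{0,0} + n∂ commutes with every L_{i,k}.

On a finite module the substitution λ = -l - ∂ turns the action into a map of finite rank over ℂ. On
a torsion-free module N such substitutions form a Vandermonde system, so they determine an action of
λ-degree less than N. Hence, if no nonzero vector is killed by everything, the vectors of bounded
λ-degree form a finite-dimensional space (`finite_of_coeffAct_eq_zero`), and linear algebra over ℂ
applies. L_{0,1} has there an eigenvector v whose eigenvalue has largest real part, and every
L_{i,k} with k ≥ 1 and (i,k) ≠ (0,1) has to kill it. Schur's lemma makes L_{0,0} + n∂ and L_{n,0}
scalars.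

For n > 1 all L̄_i with i ≥ 1 act as zero, by descending induction on i. For i = n, a nonzero scalar
L_{n,0} = β would make the commutator [L_{1,1}, L_{n-1,0}] = -β on a nonzero finite-dimensional
space, against the trace. For i = m < n the operator L_{m,0} has negative weight m - n, so it kills
an eigenvector of L_{0,1} with smallest real part. For n = 1 the scalar β survives.

Thus v spans a submodule of the form M_{Δ,α} or M_{Δ,α,β}. If the module is irreducible, this is
everything. If it is free on g, then v = f(∂)g; as f raises the λ-degree by deg f, a nonconstant f
forces Δ = β = 0 on g. The same leading-coefficient argument finds the submodules of the models.
`IsSchur` collects what the irreducible and the rank one cases share. -/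

noncomputable section

namespace LieConf

universe u v w

/-! ### Polynomials in λ through their coefficients -/

section Coefficientwise

variable {M : Type v} [AddCommGroup M]

/-- Multiplication by `λ`. -/
def lamShift (P : LamPoly M) : LamPoly M := P.embDomain ⟨Nat.succ, Nat.succ_injective⟩

lemma lamShift_zero (P : LamPoly M) : lamShift P 0 = 0 := by
  refine Finsupp.embDomain_of_notMem_range _ _ _ ?_
  rintro ⟨k, hk⟩
  exact Nat.succ_ne_zero k hk

lemma lamShift_succ (P : LamPoly M) (k : ℕ) : lamShift P (k + 1) = P k :=
  Finsupp.embDomain_apply_self ⟨Nat.succ, Nat.succ_injective⟩ P k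

variable [Module ℂ M]

/-- Applying a linear functional to the coefficients of an element of `ℂ[λ] ⊗ M`. -/
def functionalPoly (φ : M →ₗ[ℂ] ℂ) (P : LamPoly M) : ℂ[X] :=
  P.sum fun k x => monomial k (φ x)

lemma coeff_functionalPoly (φ : M →ₗ[ℂ] ℂ) (P : LamPoly M) (k : ℕ) :
    (functionalPoly φ P).coeff k = φ (P k) := by
  rw [functionalPoly, Finsupp.sum, finsetSum_coeff]
  simp only [coeff_monomial, Finset.sum_ite_eq', Finsupp.mem_support_iff]
  split_ifs with h
  · rfl
  · rw [Finsupp.notMem_support_iff.1 h, map_zero]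

/-- Functionals reduce identities between M-valued polynomials to identities in ℂ[λ], where
agreement at all complex numbers suffices. -/
lemma eq_of_functional {x y : M} (h : ∀ φ : M →ₗ[ℂ] ℂ, φ x = φ y) : x = y := by
  rw [← sub_eq_zero, ← Module.forall_dual_apply_eq_zero_iff ℂ]
  intro φ
  rw [map_sub, h, sub_self]

end Coefficientwise

/-! ### Vandermonde systems over ℂ[∂] -/

section Vandermonde

variable {M : Type v} [AddCommGroup M] [Module ℂ[X] M]

/-- A Vandermonde system with nodes `-l - ∂`, `l = 0, …, N - 1`, in a torsion-free module has only
the zero solution. -/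
lemma eq_zero_of_vandermonde [Module.IsTorsionFree ℂ[X] M] (N : ℕ) (x : Fin N → M)
    (h : ∀ l : Fin N, ∑ k : Fin N, (-C (l : ℂ) - X : ℂ[X]) ^ (k : ℕ) • x k = 0) : x = 0 := by
  set V : Matrix (Fin N) (Fin N) ℂ[X] :=
    Matrix.vandermonde fun l : Fin N => -C ((l : ℕ) : ℂ) - X with hV
  -- Two nodes differ by a nonzero constant, as ∂ cancels.
  have hdet : V.det ≠ 0 := by
    rw [hV, Matrix.det_vandermonde_ne_zero_iff]
    intro i j hij
    have : (C ((i : ℕ) : ℂ) : ℂ[X]) = C ((j : ℕ) : ℂ) := by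
      linear_combination -hij
    exact Fin.ext (Nat.cast_injective (C_injective this))
  funext k
  -- The matrix is not invertible over ℂ[∂]; the adjugate gives det • x = 0 and torsion-freeness
  -- finishes.
  have h1 : ∑ l, V.adjugate k l • ∑ j, V l j • x j = V.det • x k := by
    simp only [Finset.smul_sum, smul_smul]
    rw [Finset.sum_comm]
    simp only [← Finset.sum_smul]
    have : ∀ j, ∑ l, V.adjugate k l * V l j = if k = j then V.det else 0 := by
      intro j
      rw [← Matrix.mul_apply, Matrix.adjugate_mul, Matrix.smul_apply, Matrix.one_apply]
      simp
    simp [this, ite_smul]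
  have h2 : ∀ l, ∑ j, V l j • x j = 0 := fun l => by
    simpa [hV, Matrix.vandermonde_apply] using h l
  simp only [h2, smul_zero, Finset.sum_const_zero] at h1
  exact (smul_eq_zero.1 h1.symm).resolve_left hdet

end Vandermonde

/-! ### Evaluation of polynomials in λ -/

section LamPolyLemmas

variable {M : Type v} [AddCommGroup M] [Module ℂ M] [Module ℂ[X] M] [IsScalarTower ℂ ℂ[X] M]

lemma C_smul_eq (c : ℂ) (x : M) : (C c : ℂ[X]) • x = c • x := by
  rw [← Polynomial.algebraMap_eq, algebraMap_smul]

lemma eval_functionalPoly (φ : M →ₗ[ℂ] ℂ) (P : LamPoly M) (l : ℂ) :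
    (functionalPoly φ P).eval l = φ (lamEval (C l) P) := by
  rw [functionalPoly, lamEval_apply, Finsupp.sum, Finsupp.sum, eval_finsetSum, map_sum]
  refine Finset.sum_congr rfl fun k _ => ?_
  rw [eval_monomial, ← C_pow, C_smul_eq, map_smul, smul_eq_mul, mul_comm]

lemma lamPoly_ext {P Q : LamPoly M} (h : ∀ l : ℂ, lamEval (C l) P = lamEval (C l) Q) :
    P = Q := by
  ext k
  refine eq_of_functional fun φ => ?_
  rw [← coeff_functionalPoly, ← coeff_functionalPoly]
  congr 1
  refine Polynomial.funext fun l => ?_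
  rw [eval_functionalPoly, eval_functionalPoly, h]

lemma lamEval_single (q : ℂ[X]) (k : ℕ) (x : M) :
    lamEval q (Finsupp.single k x : LamPoly M) = q ^ k • x := by
  rw [lamEval_apply]
  exact Finsupp.sum_single_index (smul_zero _)

lemma lamEval_lamShift (q : ℂ[X]) (P : LamPoly M) :
    lamEval q (lamShift P) = q • lamEval q P := by
  rw [lamEval_apply, lamEval_apply, lamShift, Finsupp.sum_embDomain, Finsupp.smul_sum]
  refine Finset.sum_congr rfl fun k _ => ?_
  change q ^ (k + 1) • P k = q • q ^ k • P k
  rw [smul_smul, ← pow_succ']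

lemma lamEval_eq_sum_range (q : ℂ[X]) (P : LamPoly M) (N : ℕ) (h : ∀ k, N ≤ k → P k = 0) :
    lamEval q P = ∑ k ∈ Finset.range N, q ^ k • P k := by
  rw [lamEval_apply]
  refine Finsupp.sum_of_support_subset _ (fun k hk => ?_) _ (fun _ _ => smul_zero _)
  rw [Finset.mem_range]
  by_contra hN
  exact Finsupp.mem_support_iff.1 hk (h k (not_lt.1 hN))

end LamPolyLemmas

/-! ### Coefficients of the λ-action and their commutators -/

section Coefficients

variable {R : Type u} [AddCommGroup R] [Module ℂ R] [Module ℂ[X] R] [IsScalarTower ℂ ℂ[X] R]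
variable {A : LieConformalAlgebra R}
variable {M : Type v} [AddCommGroup M] [Module ℂ M] [Module ℂ[X] M] [IsScalarTower ℂ ℂ[X] M]

namespace ConformalModule

/-- The coefficient of `λ ^ k` in the `λ`-action of `a`. -/
def coeffAct (ρ : ConformalModule A M) (a : R) (k : ℕ) : M →ₗ[ℂ] M :=
  Finsupp.lapply k ∘ₗ ρ.act a

/-- The value of the `λ`-action of `a` at `λ = l`. -/
def evalAct (ρ : ConformalModule A M) (a : R) (l : ℂ) : M →ₗ[ℂ] M :=
  lamEval (C l) ∘ₗ ρ.act a

lemma coeffAct_apply (ρ : ConformalModule A M) (a : R) (k : ℕ) (v : M) :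
    ρ.coeffAct a k v = ρ.act a v k := rfl

lemma evalAct_apply (ρ : ConformalModule A M) (a : R) (l : ℂ) (v : M) :
    ρ.evalAct a l v = lamEval (C l) (ρ.act a v) := rfl

lemma coeffAct_add (ρ : ConformalModule A M) (a a' : R) (k : ℕ) :
    ρ.coeffAct (a + a') k = ρ.coeffAct a k + ρ.coeffAct a' k := by
  ext v; simp [coeffAct_apply]

lemma coeffAct_zero (ρ : ConformalModule A M) (k : ℕ) : ρ.coeffAct (0 : R) k = 0 := by
  ext v; simp [coeffAct_apply]

lemma coeffAct_smul (ρ : ConformalModule A M) (c : ℂ) (a : R) (k : ℕ) :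
    ρ.coeffAct (c • a) k = c • ρ.coeffAct a k := by
  ext v; simp [coeffAct_apply]

lemma exists_coeffAct_eq_zero (ρ : ConformalModule A M) (a : R) (v : M) :
    ∃ N, ∀ k, N ≤ k → ρ.coeffAct a k v = 0 := by
  refine ⟨(ρ.act a v).support.sup id + 1, fun k hk => ?_⟩
  by_contra h
  have : k ≤ (ρ.act a v).support.sup id :=
    Finset.le_sup (f := id) (Finsupp.mem_support_iff.2 h)
  omega

lemma act_X_smul_right (ρ : ConformalModule A M) (a : R) (v : M) :
    ρ.act a ((X : ℂ[X]) • v) = (ρ.act a v).mapRange (fun x => (X : ℂ[X]) • x) (smul_zero _) +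
      lamShift (ρ.act a v) := by
  refine lamPoly_ext fun l => ?_
  have h : lamEval (C l) ((ρ.act a v).mapRange (fun x => (X : ℂ[X]) • x) (smul_zero _)) =
      (X : ℂ[X]) • lamEval (C l) (ρ.act a v) :=
    lamEval_mapRange (LinearMap.lsmul ℂ[X] M X) _ _
  rw [ρ.sesq_right, map_add, add_smul, h, lamEval_lamShift]

lemma act_X_smul_left (ρ : ConformalModule A M) (a : R) (v : M) :
    ρ.act ((X : ℂ[X]) • a) v = -lamShift (ρ.act a v) := by
  refine lamPoly_ext fun l => ?_
  rw [ρ.sesq_left, map_neg, lamEval_lamShift, C_smul_eq]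

lemma coeffAct_zero_X_smul (ρ : ConformalModule A M) (a : R) (v : M) :
    ρ.coeffAct a 0 ((X : ℂ[X]) • v) = (X : ℂ[X]) • ρ.coeffAct a 0 v := by
  rw [coeffAct_apply, act_X_smul_right, Finsupp.add_apply, Finsupp.mapRange_apply, lamShift_zero,
    add_zero, coeffAct_apply]

lemma coeffAct_succ_X_smul (ρ : ConformalModule A M) (a : R) (k : ℕ) (v : M) :
    ρ.coeffAct a (k + 1) ((X : ℂ[X]) • v) =
      (X : ℂ[X]) • ρ.coeffAct a (k + 1) v + ρ.coeffAct a k v := by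
  rw [coeffAct_apply, act_X_smul_right, Finsupp.add_apply, Finsupp.mapRange_apply, lamShift_succ]
  rfl

lemma coeffAct_zero_X_smul_left (ρ : ConformalModule A M) (a : R) (v : M) :
    ρ.coeffAct ((X : ℂ[X]) • a) 0 v = 0 := by
  rw [coeffAct_apply, act_X_smul_left, Finsupp.neg_apply, lamShift_zero, neg_zero]

lemma coeffAct_succ_X_smul_left (ρ : ConformalModule A M) (a : R) (k : ℕ) (v : M) :
    ρ.coeffAct ((X : ℂ[X]) • a) (k + 1) v = -ρ.coeffAct a k v := by
  rw [coeffAct_apply, act_X_smul_left, Finsupp.neg_apply, lamShift_succ]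
  rfl

/-- A polynomial of degree `d` in `∂` raises the degree in `λ` of the action by `d`. -/
lemma coeffAct_smul_of_natDegree_le (ρ : ConformalModule A M) (a : R) (u : M) (k : ℕ)
    (h : ∀ j, k < j → ρ.coeffAct a j u = 0) (d : ℕ) (f : ℂ[X]) (hf : f.natDegree ≤ d) :
    (∀ j, k + d < j → ρ.coeffAct a j (f • u) = 0) ∧
      ρ.coeffAct a (k + d) (f • u) = f.coeff d • ρ.coeffAct a k u := by
  induction d generalizing f with
  | zero =>
    rw [eq_C_of_natDegree_le_zero hf]
    simp only [C_smul_eq, map_smul, coeff_C_zero, add_zero, and_true]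
    intro j hj
    rw [h j hj, smul_zero]
  | succ d ih =>
    have hg : f.divX.natDegree ≤ d := by rw [natDegree_divX_eq_natDegree_tsub_one]; omega
    obtain ⟨ih1, ih2⟩ := ih f.divX hg
    have e : f • u = (X : ℂ[X]) • f.divX • u + f.coeff 0 • u := by
      conv_lhs => rw [← divX_mul_X_add f]
      rw [add_smul, mul_comm, mul_smul, C_smul_eq]
    constructor
    · intro j hj
      obtain ⟨j, rfl⟩ : ∃ i, j = i + 1 := ⟨j - 1, by omega⟩
      rw [e, map_add, LinearMap.map_smul_of_tower _ (f.coeff 0), coeffAct_succ_X_smul, ih1 (j + 1) (by omega), ih1 j (by omega),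
        h (j + 1) (by omega)]
      simp
    · rw [e, ← add_assoc, map_add, LinearMap.map_smul_of_tower _ (f.coeff 0), coeffAct_succ_X_smul, ih1 (k + d + 1) (by omega),
        ih2, h (k + d + 1) (by omega), coeff_divX]
      simp

lemma exists_top_coeffAct (ρ : ConformalModule A M) (a : R) (u : M)
    (h : ∃ k, ρ.coeffAct a k u ≠ 0) :
    ∃ k, ρ.coeffAct a k u ≠ 0 ∧ ∀ j, k < j → ρ.coeffAct a j u = 0 := by
  obtain ⟨k, hk⟩ := h
  have hne : (ρ.act a u).support.Nonempty := ⟨k, Finsupp.mem_support_iff.2 hk⟩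
  refine ⟨(ρ.act a u).support.max' hne, Finsupp.mem_support_iff.1 (Finset.max'_mem _ _), ?_⟩
  intro j hj
  by_contra hc
  exact absurd (Finset.le_max' _ j (Finsupp.mem_support_iff.2 hc)) (not_le.2 hj)

/-- If `a _λ u ≠ 0`, then `a _λ f(∂) u ≠ 0` for `f ≠ 0`, and the `λ`-degree goes up by `deg f`. -/
lemma exists_coeffAct_smul_ne_zero (ρ : ConformalModule A M) (a : R) (u : M)
    {k : ℕ} (h : ρ.coeffAct a k u ≠ 0) {f : ℂ[X]} (hf : f ≠ 0) :
    ∃ j, k + f.natDegree ≤ j ∧ ρ.coeffAct a j (f • u) ≠ 0 := by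
  obtain ⟨j, hj, hj'⟩ := ρ.exists_top_coeffAct a u ⟨k, h⟩
  -- Here j is the top λ-degree of the action on u; the leading coefficient of f survives in front
  -- of that top coefficient.
  refine ⟨j + f.natDegree, ?_, ?_⟩
  · have : k ≤ j := not_lt.1 fun hlt => h (hj' k hlt)
    omega
  · rw [(ρ.coeffAct_smul_of_natDegree_le a u j hj' _ f le_rfl).2]
    exact smul_ne_zero (by simpa using hf) hj

/-- Moving ∂ past a coefficient only brings in the coefficient one degree lower. With S = ⊥ this
shows that being killed by a passes to ℂ[∂]-multiples. -/
lemma coeffAct_smul_mem (ρ : ConformalModule A M) (a : R) (u : M) (S : Submodule ℂ[X] M)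
    (h : ∀ k, ρ.coeffAct a k u ∈ S) (f : ℂ[X]) (k : ℕ) : ρ.coeffAct a k (f • u) ∈ S := by
  have hX : ∀ w : M, (∀ k, ρ.coeffAct a k w ∈ S) → ∀ k, ρ.coeffAct a k ((X : ℂ[X]) • w) ∈ S := by
    intro w hw k
    cases k with
    | zero => rw [coeffAct_zero_X_smul]; exact S.smul_mem _ (hw 0)
    | succ k =>
      rw [coeffAct_succ_X_smul]
      exact S.add_mem (S.smul_mem _ (hw _)) (hw k)
  have hC : ∀ (c : ℂ) (x : M), x ∈ S → c • x ∈ S := fun c x hx => by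
    rw [← C_smul_eq]; exact S.smul_mem _ hx
  induction f using Polynomial.induction_on generalizing k with
  | C c => rw [C_smul_eq, map_smul]; exact hC _ _ (h k)
  | add p q hp hq => rw [add_smul, map_add]; exact S.add_mem (hp k) (hq k)
  | monomial n c ih =>
    have : (C c * X ^ (n + 1) : ℂ[X]) • u = (X : ℂ[X]) • ((C c * X ^ n : ℂ[X]) • u) := by
      rw [smul_smul]; congr 1; ring
    rw [this]
    exact hX _ ih k

/-- The commutator of the coefficients of the actions of `a` and `b`, when
`[a _λ b] = (x ∂ + y λ) c`. -/
lemma commutator_coeffAct (ρ : ConformalModule A M) {a b c : R} {x y : ℂ}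
    (h : ∀ l : ℂ, lamEval (C l) (A.bracket a b) = (C x * X + C y * C l : ℂ[X]) • c)
    (j k : ℕ) (v : M) :
    ρ.coeffAct a j (ρ.coeffAct b k v) - ρ.coeffAct b k (ρ.coeffAct a j v) =
      (if j = 0 then 0 else ((y - x) * ((j - 1 + k).choose k : ℂ)) • ρ.coeffAct c (j - 1 + k) v) -
      (if k = 0 then 0 else
        (x * ((j + (k - 1)).choose (k - 1) : ℂ)) • ρ.coeffAct c (j + (k - 1)) v) := by
  -- Sesquilinearity replaces the ∂ in front of c by -(l + m), so x∂ + yl becomes (y - x)l - xm.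
  have jac : ∀ l m : ℂ, ρ.evalAct a l (ρ.evalAct b m v) - ρ.evalAct b m (ρ.evalAct a l v) =
      ((y - x) * l - x * m) • ρ.evalAct c (l + m) v := by
    intro l m
    simp only [evalAct_apply]
    rw [← ρ.jacobi, h, add_smul, mul_smul, mul_smul, C_smul_eq, C_smul_eq, C_smul_eq]
    simp only [map_add, LinearMap.add_apply, map_smul, LinearMap.smul_apply]
    rw [← map_add, ρ.sesq_left, smul_neg, smul_smul, smul_smul, ← neg_smul, ← add_smul]
    congr 1
    ring
  refine eq_of_functional fun φ => ?_
  set p : ℂ[X] := functionalPoly φ (ρ.act c v) with hp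
  -- Coefficient of μ^k, with λ = l fixed: c at l + μ is a Taylor shift of p, whose coefficients are
  -- Hasse derivatives at l. The factor μ lowers k by one, hence the separate case k = 0.
  have step1 : ∀ l : ℂ, φ (ρ.evalAct a l (ρ.coeffAct b k v)) -
      φ (ρ.coeffAct b k (ρ.evalAct a l v)) =
      (y - x) * l * (hasseDeriv k p).eval l -
        x * (if k = 0 then 0 else (hasseDeriv (k - 1) p).eval l) := by
    intro l
    have : functionalPoly (φ ∘ₗ ρ.evalAct a l) (ρ.act b v) -
        functionalPoly φ (ρ.act b (ρ.evalAct a l v)) =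
        C ((y - x) * l) * taylor l p - C x * (X * taylor l p) := by
      refine Polynomial.funext fun m => ?_
      have := congrArg φ (jac l m)
      simp only [eval_sub, eval_functionalPoly, eval_mul, eval_C, eval_X, taylor_eval,
        LinearMap.comp_apply]
      simp only [map_sub, map_smul, smul_eq_mul, evalAct_apply] at this ⊢
      rw [this, hp, eval_functionalPoly, add_comm m l]
      ring
    have := congrArg (fun q => coeff q k) this
    simp only [coeff_sub, coeff_functionalPoly, coeff_C_mul, taylor_coeff] at this
    refine this.trans ?_
    congr 2
    cases k with
    | zero => simp
    | succ k => simp [coeff_X_mul, taylor_coeff]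
  -- The same identity as polynomials in λ; the coefficients of the Hasse derivatives then supply
  -- the binomials.
  have step2 : functionalPoly φ (ρ.act a (ρ.coeffAct b k v)) -
      functionalPoly (φ ∘ₗ ρ.coeffAct b k) (ρ.act a v) =
      C (y - x) * (X * hasseDeriv k p) -
        C x * (if k = 0 then 0 else hasseDeriv (k - 1) p) := by
    refine Polynomial.funext fun l => ?_
    have := step1 l
    simp only [eval_sub, eval_functionalPoly, eval_mul, eval_C, eval_X,
        LinearMap.comp_apply]
    rw [evalAct_apply, evalAct_apply] at this
    rw [this]
    split_ifs <;> simp <;> ring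
  have step3 := congrArg (fun q => coeff q j) step2
  simp only [coeff_sub, coeff_functionalPoly, coeff_C_mul] at step3
  rw [map_sub, coeffAct_apply, map_sub]
  refine step3.trans ?_
  congr 1
  · cases j with
    | zero => simp
    | succ j => simp [coeff_X_mul, hasseDeriv_coeff, hp, coeff_functionalPoly, coeffAct_apply,
        mul_assoc]
  · split_ifs with hk
    · simp
    · simp [hasseDeriv_coeff, hp, coeff_functionalPoly, coeffAct_apply, mul_assoc]

/-- The value of `a _λ u` at `λ = -l - ∂`. -/
def skewEval (ρ : ConformalModule A M) (a : R) (l : ℂ) : M →ₗ[ℂ] M :=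
  lamEval (-C l - X) ∘ₗ ρ.act a

/-- At λ = -l - ∂ the factor ∂ + λ of sesquilinearity is the scalar -l. This is the reason for the
substitution: ℂ[∂] then acts through complex numbers. -/
lemma skewEval_X_smul (ρ : ConformalModule A M) (a : R) (l : ℂ) (u : M) :
    ρ.skewEval a l ((X : ℂ[X]) • u) = (-l) • ρ.skewEval a l u := by
  have h : lamEval (-C l - X) ((ρ.act a u).mapRange (fun x => (X : ℂ[X]) • x) (smul_zero _)) =
      (X : ℂ[X]) • lamEval (-C l - X) (ρ.act a u) :=
    lamEval_mapRange (LinearMap.lsmul ℂ[X] M X) _ _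
  rw [skewEval, LinearMap.comp_apply, LinearMap.comp_apply, act_X_smul_right, map_add, h,
    lamEval_lamShift, ← add_smul, ← C_smul_eq]
  congr 1
  simp

lemma skewEval_smul (ρ : ConformalModule A M) (a : R) (l : ℂ) (f : ℂ[X]) (u : M) :
    ρ.skewEval a l (f • u) = f.eval (-l) • ρ.skewEval a l u := by
  induction f using Polynomial.induction_on with
  | C c => rw [C_smul_eq, map_smul, eval_C]
  | add p q hp hq => rw [add_smul, map_add, hp, hq, eval_add, add_smul]
  | monomial n c ih =>
    have : (C c * X ^ (n + 1) : ℂ[X]) • u = (X : ℂ[X]) • ((C c * X ^ n : ℂ[X]) • u) := by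
      rw [smul_smul]; congr 1; ring
    rw [this, skewEval_X_smul, ih, smul_smul]
    congr 1
    simp; ring

/-- For a finite module the substitution `λ = -l - ∂` in the action has finite rank. -/
lemma finite_range_skewEval [Module.Finite ℂ[X] M] (ρ : ConformalModule A M) (a : R) (l : ℂ) :
    Module.Finite ℂ (LinearMap.range (ρ.skewEval a l)) := by
  obtain ⟨s, hs⟩ := Module.Finite.fg_top (R := ℂ[X]) (M := M)
  classical
  -- Since f(∂) comes out as the number f(-l), the images of the ℂ[∂]-generators span the range over
  -- ℂ.
  have : LinearMap.range (ρ.skewEval a l) ≤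
      Submodule.span ℂ ((s.image (ρ.skewEval a l) : Finset M) : Set M) := by
    rintro _ ⟨u, rfl⟩
    have hu : u ∈ Submodule.span ℂ[X] (s : Set M) := hs ▸ Submodule.mem_top
    induction hu using Submodule.span_induction with
    | mem x hx => exact Submodule.subset_span (by simpa using ⟨x, hx, rfl⟩)
    | zero => simp
    | add x y _ _ hx hy => rw [map_add]; exact Submodule.add_mem _ hx hy
    | smul f x _ hx => rw [skewEval_smul]; exact Submodule.smul_mem _ _ hx
  exact Submodule.finiteDimensional_of_le this

/-- A complex subspace of a finite torsion-free module on which the actions of finitely many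
elements have bounded `λ`-degree, and on which these elements have no common trivial vector, is
finite-dimensional. -/
lemma finite_of_coeffAct_eq_zero [Module.Finite ℂ[X] M] [Module.IsTorsionFree ℂ[X] M]
    (ρ : ConformalModule A M) {ι : Type*} [Finite ι] (a : ι → R) (N : ℕ) (W : Submodule ℂ M)
    (hN : ∀ u ∈ W, ∀ i k, N ≤ k → ρ.coeffAct (a i) k u = 0)
    (h0 : ∀ u ∈ W, (∀ i k, ρ.coeffAct (a i) k u = 0) → u = 0) : Module.Finite ℂ W := by
  have := fun p : ι × Fin N => ρ.finite_range_skewEval (a p.1) ((p.2 : ℕ) : ℂ)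
  let Ψ : W →ₗ[ℂ] (p : ι × Fin N) → LinearMap.range (ρ.skewEval (a p.1) ((p.2 : ℕ) : ℂ)) :=
    LinearMap.pi fun p => (ρ.skewEval (a p.1) ((p.2 : ℕ) : ℂ)).rangeRestrict ∘ₗ W.subtype
  refine Module.Finite.of_injective Ψ ((injective_iff_map_eq_zero Ψ).2 ?_)
  rintro ⟨u, hu⟩ hΨ
  refine Subtype.ext (h0 u hu fun i k => ?_)
  -- Vanishing at λ = -l - ∂ for l = 0, …, N - 1 is a Vandermonde system in the N possibly nonzero
  -- coefficients.
  have hz : (fun k : Fin N => ρ.coeffAct (a i) k u) = 0 := by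
    refine eq_zero_of_vandermonde N _ fun l => ?_
    have h1 : ρ.skewEval (a i) ((l : ℕ) : ℂ) u = 0 := congrArg Subtype.val (congrFun hΨ (i, l))
    rw [skewEval, LinearMap.comp_apply, lamEval_eq_sum_range _ _ N (hN u hu i),
      ← Fin.sum_univ_eq_sum_range (fun k => (-C ((l : ℕ) : ℂ) - X : ℂ[X]) ^ k •
        (ρ.act (a i) u) k)] at h1
    exact h1
  by_cases hk : k < N
  · exact congrFun hz ⟨k, hk⟩
  · exact hN u hu i k (not_lt.1 hk)

end ConformalModule

end Coefficients

/-! ### Extremal eigenvectors -/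

section Eigenvector

variable {M : Type v} [AddCommGroup M] [Module ℂ M]

/-- An operator on a nonzero finite-dimensional complex space has an eigenvector whose eigenvalue
has the largest possible real part. -/
lemma exists_eigenvector_max_re (H : M →ₗ[ℂ] M) (W : Submodule ℂ M) [Module.Finite ℂ W]
    (hW : W ≠ ⊥) (hH : ∀ u ∈ W, H u ∈ W) :
    ∃ (Δ : ℂ) (v : M), v ∈ W ∧ v ≠ 0 ∧ H v = Δ • v ∧
      ∀ u ∈ W, ∀ c : ℂ, 0 < c.re → H u = (Δ + c) • u → u = 0 := by
  have : Nontrivial W := Submodule.nontrivial_iff_ne_bot.2 hW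
  set T : Module.End ℂ W := H.restrict hH
  obtain ⟨c, hc⟩ := Module.End.exists_eigenvalue T
  have hfin : {μ | T.HasEigenvalue μ}.Finite := Module.End.finite_hasEigenvalue T
  obtain ⟨Δ, hΔ, hmax⟩ := Set.exists_max_image _ Complex.re hfin ⟨c, hc⟩
  obtain ⟨v, hv⟩ := Module.End.HasEigenvalue.exists_hasEigenvector hΔ
  refine ⟨Δ, v, v.2, fun h => hv.2 (Subtype.ext h), congrArg Subtype.val hv.apply_eq_smul, ?_⟩
  intro u hu e he hue
  by_contra hne
  have hev : T.HasEigenvalue (Δ + e) :=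
    Module.End.hasEigenvalue_of_hasEigenvector (x := ⟨u, hu⟩)
      ⟨Module.End.mem_eigenspace_iff.2 (Subtype.ext hue), fun h => hne (congrArg Subtype.val h)⟩
  have := hmax _ hev
  rw [Complex.add_re] at this
  linarith

end Eigenvector

/-! ### The annihilation algebra of 𝔟(n) and its finite-dimensional invariant subspaces -/

namespace ConformalModule

variable {n : ℕ}
variable {M : Type v} [AddCommGroup M] [Module ℂ M] [Module ℂ[X] M] [IsScalarTower ℂ ℂ[X] M]

/-- The coefficient of `λ ^ k` in the `λ`-action of `L̄_i`. -/
def mode (ρ : ConformalModule (b n) M) (i k : ℕ) : M →ₗ[ℂ] M := ρ.coeffAct (bL n i) k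

lemma mode_eq_zero_of_lt (ρ : ConformalModule (b n) M) {i : ℕ} (h : n < i) (k : ℕ) :
    ρ.mode i k = 0 := by
  rw [mode, bL_eq_zero n i h, coeffAct_zero]

/-- The general commutator with x = i - n, y = i + j - 2n, hence y - x = j - n. -/
lemma commutator_mode (ρ : ConformalModule (b n) M) (i j s t : ℕ) (v : M) :
    ρ.mode i s (ρ.mode j t v) - ρ.mode j t (ρ.mode i s v) =
      (if s = 0 then 0 else
        (((j : ℂ) - n) * ((s - 1 + t).choose t : ℂ)) • ρ.mode (i + j) (s - 1 + t) v) -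
      (if t = 0 then 0 else
        (((i : ℂ) - n) * ((s + (t - 1)).choose (t - 1) : ℂ)) •
          ρ.mode (i + j) (s + (t - 1)) v) := by
  have h := ρ.commutator_coeffAct (fun l => lamEval_b_bracket n i j (C l)) s t v
  have e : (i : ℂ) + j - 2 * n - (i - n) = j - n := by ring
  rw [e] at h
  exact h

lemma mode_comm (ρ : ConformalModule (b n) M) {i j : ℕ} (h : ∀ k, ρ.mode (i + j) k = 0)
    (s t : ℕ) (v : M) : ρ.mode i s (ρ.mode j t v) = ρ.mode j t (ρ.mode i s v) := by
  have := ρ.commutator_mode i j s t v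
  simp only [h, LinearMap.zero_apply, smul_zero, ite_self, sub_zero] at this
  exact sub_eq_zero.1 this

/-- Only the λ-degree s + t ≥ t matters: operators with a positive second index never lower t, so
they preserve a bound on the λ-degree. -/
lemma exists_commutator_mode_succ (ρ : ConformalModule (b n) M) (i j s t : ℕ) (v : M) :
    ∃ c : ℂ, ρ.mode i (s + 1) (ρ.mode j t v) - ρ.mode j t (ρ.mode i (s + 1) v) =
      c • ρ.mode (i + j) (s + t) v := by
  rw [commutator_mode]
  cases t with
  | zero => exact ⟨_, by simp; rfl⟩
  | succ t =>
    refine ⟨((j : ℂ) - n) * ((s + (t + 1)).choose (t + 1) : ℂ) -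
      ((i : ℂ) - n) * ((s + 1 + t).choose t : ℂ), ?_⟩
    have : s + 1 + t = s + (t + 1) := by ring
    simp [this, sub_smul]

lemma mode_zero_zero_comm_zero (ρ : ConformalModule (b n) M) (j : ℕ) (v : M) :
    ρ.mode 0 0 (ρ.mode j 0 v) = ρ.mode j 0 (ρ.mode 0 0 v) := by
  have := ρ.commutator_mode 0 j 0 0 v
  simpa [sub_eq_zero] using this

/-- By comparison with `mode_succ_X_smul`, L_{0,0} has the commutators of -n∂. -/
lemma mode_zero_zero_comm_succ (ρ : ConformalModule (b n) M) (j k : ℕ) (v : M) :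
    ρ.mode 0 0 (ρ.mode j (k + 1) v) = ρ.mode j (k + 1) (ρ.mode 0 0 v) + (n : ℂ) • ρ.mode j k v := by
  have := ρ.commutator_mode 0 j 0 (k + 1) v
  simp only [if_true, Nat.add_eq_zero_iff, one_ne_zero, and_false, if_false, Nat.add_sub_cancel,
    zero_add, Nat.choose_self, Nat.cast_zero, zero_sub, Nat.cast_one, mul_one, neg_smul,
    neg_neg] at this
  rw [← this]; abel

/-- L_{0,1} is the grading operator. For n ≥ 1 the weight is positive when k ≥ 1, except at (0,1),
and it is j - n when k = 0. -/
lemma mode_zero_one_comm (ρ : ConformalModule (b n) M) (j k : ℕ) (v : M) :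
    ρ.mode 0 1 (ρ.mode j k v) =
      ρ.mode j k (ρ.mode 0 1 v) + ((j : ℂ) + n * ((k : ℂ) - 1)) • ρ.mode j k v := by
  have h := ρ.commutator_mode 0 j 1 k v
  rw [sub_eq_iff_eq_add'] at h
  rw [h]
  congr 1
  cases k with
  | zero => simp; rw [← sub_eq_add_neg]
  | succ k =>
    have : 1 + k = k + 1 := add_comm _ _
    simp only [one_ne_zero, if_false, Nat.sub_self, zero_add, Nat.choose_self, Nat.cast_one,
      mul_one, Nat.add_eq_zero_iff, and_false, Nat.add_sub_cancel, this, Nat.choose_succ_self_right,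
      Nat.cast_zero, zero_sub, Nat.cast_add]
    rw [← sub_smul]
    congr 1
    ring

lemma mode_zero_X_smul (ρ : ConformalModule (b n) M) (i : ℕ) (v : M) :
    ρ.mode i 0 ((X : ℂ[X]) • v) = (X : ℂ[X]) • ρ.mode i 0 v := ρ.coeffAct_zero_X_smul _ v

lemma mode_succ_X_smul (ρ : ConformalModule (b n) M) (i k : ℕ) (v : M) :
    ρ.mode i (k + 1) ((X : ℂ[X]) • v) = (X : ℂ[X]) • ρ.mode i (k + 1) v + ρ.mode i k v :=
  ρ.coeffAct_succ_X_smul _ k v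

/-- The coefficient of `λ ^ 0` in the action of `L̄_i` is `ℂ[∂]`-linear. -/
def modeZeroLinear (ρ : ConformalModule (b n) M) (i : ℕ) : M →ₗ[ℂ[X]] M where
  toFun := ρ.mode i 0
  map_add' := map_add _
  map_smul' f u := by
    rw [RingHom.id_apply]
    induction f using Polynomial.induction_on with
    | C c => rw [C_smul_eq, map_smul, C_smul_eq]
    | add p q hp hq => rw [add_smul, map_add, hp, hq, add_smul]
    | monomial k c ih =>
      have : (C c * X ^ (k + 1) : ℂ[X]) = X * (C c * X ^ k) := by ring
      rw [this, mul_smul, mode_zero_X_smul, ih, smul_smul]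

lemma modeZeroLinear_apply (ρ : ConformalModule (b n) M) (i : ℕ) (u : M) :
    ρ.modeZeroLinear i u = ρ.mode i 0 u := rfl

/-- The vectors on which the action has degree less than `N` in `λ`. -/
def boundedSubspace (ρ : ConformalModule (b n) M) (N : ℕ) : Submodule ℂ M where
  carrier := {u | ∀ i k, N ≤ k → ρ.mode i k u = 0}
  add_mem' hu hv i k hk := by rw [map_add, hu i k hk, hv i k hk, add_zero]
  zero_mem' i k _ := map_zero _
  smul_mem' c u hu i k hk := by rw [map_smul, hu i k hk, smul_zero]

lemma exists_mem_boundedSubspace (ρ : ConformalModule (b n) M) (u : M) :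
    ∃ N, u ∈ ρ.boundedSubspace N := by
  choose N hN using fun i => ρ.exists_coeffAct_eq_zero (bL n i) u
  refine ⟨(Finset.range (n + 1)).sup N, fun i k hk => ?_⟩
  by_cases hi : i ≤ n
  · exact hN i k ((Finset.le_sup (Finset.mem_range.2 (Nat.lt_succ_of_le hi))).trans hk)
  · rw [ρ.mode_eq_zero_of_lt (not_le.1 hi), LinearMap.zero_apply]

lemma mode_succ_mem_boundedSubspace (ρ : ConformalModule (b n) M) (i s : ℕ) {N : ℕ} {u : M}
    (hu : u ∈ ρ.boundedSubspace N) : ρ.mode i (s + 1) u ∈ ρ.boundedSubspace N := by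
  intro j t ht
  obtain ⟨c, hc⟩ := ρ.exists_commutator_mode_succ i j s t u
  rw [hu j t ht, hu (i + j) (s + t) (by omega), map_zero, smul_zero, zero_sub, neg_eq_zero] at hc
  exact hc

/-- The vectors on which the action of `L̄_m` is independent of `λ`. -/
def constSubspace (ρ : ConformalModule (b n) M) (m : ℕ) : Submodule ℂ M where
  carrier := {u | ∀ k, ρ.mode m (k + 1) u = 0}
  add_mem' hu hv k := by rw [map_add, hu k, hv k, add_zero]
  zero_mem' k := map_zero _
  smul_mem' c u hu k := by rw [map_smul, hu k, smul_zero]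

/-- When L̄_{i+m} acts as zero, L̄_i and L̄_m commute. -/
lemma mode_mem_constSubspace (ρ : ConformalModule (b n) M) {i m : ℕ}
    (h : ∀ k, ρ.mode (i + m) k = 0) (s : ℕ) {u : M} (hu : u ∈ ρ.constSubspace m) :
    ρ.mode i s u ∈ ρ.constSubspace m := by
  intro k
  rw [← ρ.mode_comm h, hu k, map_zero]

/-- The properties shared by nontrivial irreducible modules and nontrivial free modules of rank one
from which a common eigenvector of the annihilation algebra is found. -/
structure IsSchur (ρ : ConformalModule (b n) M) : Prop where
  eq_zero_of_trivial : ∀ u, (∀ i k, ρ.mode i k u = 0) → u = 0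
  endo_eq_zero : ∀ T : M →ₗ[ℂ[X]] M, (∀ i k u, T (ρ.mode i k u) = ρ.mode i k (T u)) →
    (∃ u, u ≠ 0 ∧ T u = 0) → T = 0
  mode_eq_zero : ∀ m, (∀ i, 1 ≤ i → ∀ k, ρ.mode (i + m) k = 0) →
    (∃ u, u ≠ 0 ∧ ∀ k, ρ.mode m k u = 0) → ∀ k, ρ.mode m k = 0

/-! ### Schur's lemma, highest vectors and vanishing of L̄_1, …, L̄_n -/

section Schur

variable [Module.Finite ℂ[X] M] [Module.IsTorsionFree ℂ[X] M]

lemma finite_boundedSubspace (ρ : ConformalModule (b n) M) (hρ : ρ.IsSchur) (N : ℕ) :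
    Module.Finite ℂ (ρ.boundedSubspace N) := by
  refine ρ.finite_of_coeffAct_eq_zero (fun i : Fin (n + 1) => bL n i) N _
    (fun u hu i k hk => hu i k hk) (fun u _ h => hρ.eq_zero_of_trivial u fun i k => ?_)
  by_cases hi : i ≤ n
  · exact h ⟨i, Nat.lt_succ_of_le hi⟩ k
  · rw [ρ.mode_eq_zero_of_lt (not_le.1 hi), LinearMap.zero_apply]

/-- The finiteness criterion for the single element L̄_m with degree bound N = 1. -/
lemma finite_constSubspace (ρ : ConformalModule (b n) M) (m : ℕ)
    (h : ∀ u, (∀ k, ρ.mode m k u = 0) → u = 0) : Module.Finite ℂ (ρ.constSubspace m) :=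
  ρ.finite_of_coeffAct_eq_zero (fun _ : Unit => bL n m) 1 _
    (fun u hu _ k hk => by
      obtain ⟨k, rfl⟩ : ∃ j, k = j + 1 := ⟨k - 1, by omega⟩
      exact hu k)
    (fun u _ h' => h u (h' ()))

/-- Schur's lemma. -/
lemma IsSchur.exists_eq_smul [Nontrivial M] {ρ : ConformalModule (b n) M} (hρ : ρ.IsSchur)
    (T : M →ₗ[ℂ[X]] M) (hT : ∀ i k u, T (ρ.mode i k u) = ρ.mode i k (T u)) :
    ∃ c : ℂ, ∀ u, T u = c • u := by
  obtain ⟨u, hu⟩ := exists_ne (0 : M)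
  obtain ⟨N, hN⟩ := ρ.exists_mem_boundedSubspace u
  have := ρ.finite_boundedSubspace hρ N
  -- T commutes with the modes, so it preserves a finite-dimensional space of bounded λ-degree; its
  -- eigenvector there gives T - c a kernel.
  obtain ⟨c, v, -, hv0, hv, -⟩ := exists_eigenvector_max_re (T.restrictScalars ℂ)
    (ρ.boundedSubspace N) ((Submodule.ne_bot_iff _).2 ⟨u, hN, hu⟩)
    (fun w hw i k hk => by
      rw [LinearMap.restrictScalars_apply, ← hT, hw i k hk, map_zero])
  refine ⟨c, fun w => ?_⟩
  have h0 := hρ.endo_eq_zero (T - (C c : ℂ[X]) • LinearMap.id)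
    (fun i k w => by
      simp only [LinearMap.sub_apply, LinearMap.smul_apply, LinearMap.id_apply, hT, C_smul_eq,
        map_sub, map_smul])
    ⟨v, hv0, by
      simpa [C_smul_eq, sub_eq_zero] using hv⟩
  simpa [C_smul_eq, sub_eq_zero] using LinearMap.congr_fun h0 w

/-- L_{0,0} + n∂ is ℂ[∂]-linear and commutes with all modes, so it is a scalar c, and α solves c =
-nα. -/
lemma IsSchur.exists_mode_zero_zero [Nontrivial M] {ρ : ConformalModule (b n) M} (hρ : ρ.IsSchur)
    (hn : 1 ≤ n) : ∃ α : ℂ, ∀ u, ρ.mode 0 0 u = (C (-(n : ℂ)) * (X + C α) : ℂ[X]) • u := by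
  obtain ⟨c, hc⟩ := hρ.exists_eq_smul
    (ρ.modeZeroLinear 0 + (C (n : ℂ) * X : ℂ[X]) • LinearMap.id) (fun i k u => by
      simp only [LinearMap.add_apply, LinearMap.smul_apply, LinearMap.id_apply, map_add,
        modeZeroLinear_apply, mul_smul, C_smul_eq, map_smul]
      cases k with
      | zero => rw [mode_zero_zero_comm_zero, mode_zero_X_smul]
      | succ k =>
        rw [mode_zero_zero_comm_succ, mode_succ_X_smul, smul_add]
        abel)
  have hn0 : (n : ℂ) ≠ 0 := Nat.cast_ne_zero.2 (by omega)
  refine ⟨-c / n, fun u => ?_⟩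
  have e : (C (-(n : ℂ)) * (X + C (-c / n)) : ℂ[X]) = C c - C (n : ℂ) * X := by
    have h1 : (C (-(n : ℂ)) * C (-c / n) : ℂ[X]) = C c := by
      rw [← C_mul]; congr 1; field_simp
    rw [mul_add, h1, map_neg]; ring
  have := hc u
  simp only [LinearMap.add_apply, LinearMap.smul_apply, LinearMap.id_apply,
    modeZeroLinear_apply] at this
  rw [e, sub_smul, C_smul_eq, ← this]
  abel

/-- L_{n,0} is central: its commutator with L_{0,k} carries the factor n - n, and L̄_{i+n} = 0 for i
≥ 1. -/
lemma IsSchur.exists_mode_top_zero [Nontrivial M] {ρ : ConformalModule (b n) M} (hρ : ρ.IsSchur) :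
    ∃ β : ℂ, ∀ u, ρ.mode n 0 u = β • u := by
  refine hρ.exists_eq_smul (ρ.modeZeroLinear n) fun i k u => ?_
  rw [modeZeroLinear_apply, modeZeroLinear_apply]
  rcases Nat.eq_zero_or_pos i with rfl | hi
  · have := ρ.commutator_mode 0 n k 0 u
    simp only [sub_self, zero_mul, zero_smul, ite_self, if_true] at this
    exact (sub_eq_zero.1 this).symm
  · exact ρ.mode_comm (fun k => ρ.mode_eq_zero_of_lt (by omega) k) _ _ _

/-- There is an eigenvector of the degree operator `L_(0,1)` killed by all operators of positive
degree. -/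
lemma IsSchur.exists_highest_vector [Nontrivial M] {ρ : ConformalModule (b n) M} (hρ : ρ.IsSchur)
    (hn : 1 ≤ n) : ∃ (c : ℂ) (v : M), v ≠ 0 ∧ ρ.mode 0 1 v = c • v ∧
      (∀ k, 2 ≤ k → ρ.mode 0 k v = 0) ∧ ∀ i, 1 ≤ i → v ∈ ρ.constSubspace i := by
  obtain ⟨u, hu⟩ := exists_ne (0 : M)
  obtain ⟨N, hN⟩ := ρ.exists_mem_boundedSubspace u
  have := ρ.finite_boundedSubspace hρ N
  obtain ⟨c, v, hvN, hv0, hv, hmax⟩ := exists_eigenvector_max_re (ρ.mode 0 1)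
    (ρ.boundedSubspace N) ((Submodule.ne_bot_iff _).2 ⟨u, hN, hu⟩)
    (fun w hw => ρ.mode_succ_mem_boundedSubspace 0 0 hw)
  -- The condition says that the weight i + nk of L_{i,k+1} is positive; such an operator would
  -- carry v to an eigenvalue of larger real part.
  have key : ∀ i k : ℕ, n < i + n * (k + 1) → ρ.mode i (k + 1) v = 0 := by
    intro i k hik
    refine hmax _ (ρ.mode_succ_mem_boundedSubspace i k hvN)
      ((i : ℂ) + n * (((k + 1 : ℕ) : ℂ) - 1)) ?_ ?_
    · have : (0 : ℝ) < i + n * k := by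
        have : 0 < i + n * k := by rw [mul_add] at hik; omega
        exact_mod_cast this
      simpa using this
    · rw [mode_zero_one_comm, hv, map_smul, ← add_smul]
  refine ⟨c, v, hv0, hv, fun k hk => ?_, fun i hi k => key i k ?_⟩
  · obtain ⟨k, rfl⟩ : ∃ j, k = j + 1 := ⟨k - 1, by omega⟩
    refine key 0 k ?_
    nlinarith
  · nlinarith

/-- For `n > 1` the element `L̄_n` acts trivially. -/
lemma IsSchur.mode_top_eq_zero [Nontrivial M] {ρ : ConformalModule (b n) M} (hρ : ρ.IsSchur)
    (hn : 1 < n) (k : ℕ) : ρ.mode n k = 0 := by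
  have hbig : ∀ i, 1 ≤ i → ∀ k, ρ.mode (i + n) k = 0 :=
    fun i hi k => ρ.mode_eq_zero_of_lt (by omega) k
  obtain ⟨c, v, hv0, -, -, hv⟩ := hρ.exists_highest_vector hn.le
  obtain ⟨β, hβ⟩ := hρ.exists_mode_top_zero
  -- If β ≠ 0, then L̄_n has no kernel and `constSubspace n` is finite-dimensional. L_{1,1} and
  -- L_{n-1,0} preserve it because 1 and n - 1 are both positive, and their commutator there is -β,
  -- which must have trace zero.
  have hβ0 : β = 0 := by
    by_contra hne
    have := ρ.finite_constSubspace n fun u hu => by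
      have := hu 0
      rw [hβ] at this
      exact (smul_eq_zero.1 this).resolve_left hne
    let P : Module.End ℂ (ρ.constSubspace n) :=
      (ρ.mode 1 1).restrict fun u hu => ρ.mode_mem_constSubspace (hbig 1 le_rfl) 1 hu
    let Q : Module.End ℂ (ρ.constSubspace n) :=
      (ρ.mode (n - 1) 0).restrict fun u hu =>
        ρ.mode_mem_constSubspace (hbig (n - 1) (by omega)) 0 hu
    have hPQ : P * Q - Q * P = (-β) • (1 : Module.End ℂ (ρ.constSubspace n)) := by
      ext ⟨u, hu⟩
      have := ρ.commutator_mode 1 (n - 1) 1 0 u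
      have e : 1 + (n - 1) = n := by omega
      have e' : ((n - 1 : ℕ) : ℂ) - n = -1 := by
        rw [Nat.cast_sub hn.le]; push_cast; ring
      rw [e, e'] at this
      simp [hβ] at this
      simpa [P, Q] using this
    have htr := congrArg (LinearMap.trace ℂ _) hPQ
    rw [map_sub, LinearMap.trace_mul_comm, sub_self, map_smul, LinearMap.trace_one, smul_eq_mul,
      eq_comm, mul_eq_zero, neg_eq_zero, Nat.cast_eq_zero] at htr
    have h0 := htr.resolve_left hne
    have := Module.finrank_zero_iff.1 h0
    exact hv0 (congrArg Subtype.val (Subsingleton.elim (⟨v, hv n hn.le⟩ : ρ.constSubspace n) 0))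
  refine hρ.mode_eq_zero n hbig ⟨v, hv0, fun k => ?_⟩ k
  cases k with
  | zero => rw [hβ, hβ0, zero_smul]
  | succ k => exact hv n hn.le k

/-- For `n > 1` the elements `L̄_1, …, L̄_n` act trivially. -/
lemma IsSchur.mode_eq_zero_of_pos [Nontrivial M] {ρ : ConformalModule (b n) M} (hρ : ρ.IsSchur)
    (hn : 1 < n) {i : ℕ} (hi : 1 ≤ i) (k : ℕ) : ρ.mode i k = 0 := by
  obtain ⟨c, v, hv0, -, -, hv⟩ := hρ.exists_highest_vector hn.le
  -- Descending induction on i, with d bounding n - i.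
  have key : ∀ d i, 1 ≤ i → n ≤ i + d → ∀ k, ρ.mode i k = 0 := by
    intro d
    induction d with
    | zero =>
      intro i hi h k
      rcases h.lt_or_eq with h | h
      · exact ρ.mode_eq_zero_of_lt h k
      · obtain rfl : n = i := h
        exact hρ.mode_top_eq_zero hn k
    | succ d ih =>
      intro m hm h k
      have hbig : ∀ i, 1 ≤ i → ∀ k, ρ.mode (i + m) k = 0 :=
        fun i hi k => ih (i + m) (by omega) (by omega) k
      by_cases hmn : n ≤ m
      · exact ih m hm (by omega) k
      refine hρ.mode_eq_zero m hbig ?_ k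
      by_contra hcon
      push Not at hcon
      have := ρ.finite_constSubspace m fun u hu => by
        by_contra hne
        obtain ⟨k, hk⟩ := hcon u hne
        exact hk (hu k)
      -- The sign makes L_{m,0}, of weight m - n < 0 for L_{0,1}, raise the eigenvalue by n - m. So
      -- it kills w, contradicting the absence of a kernel of L̄_m.
      obtain ⟨c, w, hw, hw0, hwc, hmax⟩ := exists_eigenvector_max_re (-ρ.mode 0 1)
        (ρ.constSubspace m) ((Submodule.ne_bot_iff _).2 ⟨v, hv m hm, hv0⟩)
        (fun u hu k => by
          rw [LinearMap.neg_apply, map_neg, neg_eq_zero]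
          have := ρ.mode_zero_one_comm m (k + 1) u
          rw [hu k, map_zero, smul_zero, add_zero] at this
          exact this.symm)
      obtain ⟨k, hk⟩ := hcon w hw0
      cases k with
      | succ k => exact hk (hw k)
      | zero =>
        refine hk (hmax _ (ρ.mode_mem_constSubspace (hbig m hm) 0 hw) ((n : ℂ) - m) ?_ ?_)
        · have : (m : ℝ) < n := by exact_mod_cast not_le.1 hmn
          simpa using this
        · have h1 : ρ.mode 0 1 w = (-c) • w := by
            rw [neg_smul, ← hwc, LinearMap.neg_apply, neg_neg]
          rw [LinearMap.neg_apply, mode_zero_one_comm, h1, map_smul, ← add_smul, ← neg_smul]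
          congr 1
          push_cast
          ring
  exact key n i hi (by omega) k

end Schur

end ConformalModule

/-! ### Reduction to generators; modules spanned by one vector -/

section Generators

variable {n : ℕ}
variable {M : Type v} [AddCommGroup M] [Module ℂ M] [Module ℂ[X] M] [IsScalarTower ℂ ℂ[X] M]
variable {N : Type w} [AddCommGroup N] [Module ℂ N] [Module ℂ[X] N] [IsScalarTower ℂ ℂ[X] N]

/-- Induction on elements of `𝔟(n)`, which is generated by the `L̄_i` over `ℂ[∂]`. -/
lemma b_induction {P : BlockCarrier ⧸ blockTail (n + 1) → Prop} (zero : P 0)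
    (add : ∀ x y, P x → P y → P (x + y)) (smul : ∀ (c : ℂ) x, P x → P (c • x))
    (smul_X : ∀ x, P x → P ((X : ℂ[X]) • x)) (gen : ∀ i, P (bL n i))
    (a : BlockCarrier ⧸ blockTail (n + 1)) : P a := by
  obtain ⟨a, rfl⟩ := (blockTail (n + 1)).mkQ_surjective a
  induction a using Finsupp.induction_linear with
  | zero => rw [map_zero]; exact zero
  | add x y hx hy => rw [map_add]; exact add _ _ hx hy
  | single i f =>
    have e : (Finsupp.single i f : BlockCarrier) = f • blockL i := by
      rw [blockL, Finsupp.smul_single, smul_eq_mul, mul_one]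
    rw [e, map_smul]
    change P (f • bL n i)
    clear e
    induction f using Polynomial.induction_on with
    | C c => rw [C_smul_eq]; exact smul _ _ (gen i)
    | add p q hp hq => rw [add_smul]; exact add _ _ hp hq
    | monomial k c ih =>
      have : (C c * X ^ (k + 1) : ℂ[X]) = X * (C c * X ^ k) := by ring
      rw [this, mul_smul]
      exact smul_X _ ih

namespace ConformalModule

/-- The L̄_i suffice, since ∂ on the algebra side only shifts the coefficients and changes their
sign. -/
lemma isConformalSubmodule_iff (ρ : ConformalModule (b n) M) (S : Submodule ℂ[X] M) :
    ρ.IsConformalSubmodule S ↔ ∀ i k, ∀ v ∈ S, ρ.mode i k v ∈ S := by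
  refine ⟨fun h i k v hv => h _ v hv k, fun h a v hv => ?_⟩
  change ∀ k, ρ.coeffAct a k v ∈ S
  induction a using b_induction with
  | zero => intro k; rw [coeffAct_zero]; exact S.zero_mem
  | add x y hx hy => intro k; rw [coeffAct_add]; exact S.add_mem (hx k) (hy k)
  | smul c x hx =>
    intro k
    rw [coeffAct_smul, LinearMap.smul_apply, ← C_smul_eq]
    exact S.smul_mem _ (hx k)
  | smul_X x hx =>
    intro k
    cases k with
    | zero => rw [coeffAct_zero_X_smul_left]; exact S.zero_mem
    | succ k => rw [coeffAct_succ_X_smul_left]; exact S.neg_mem (hx k)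
  | gen i => intro k; exact h i k v hv

lemma act_eq_zero_of_mode (ρ : ConformalModule (b n) M) {v : M} (h : ∀ i k, ρ.mode i k v = 0)
    (a : BlockCarrier ⧸ blockTail (n + 1)) : ρ.act a v = 0 := by
  refine Finsupp.ext fun k => ?_
  change ρ.coeffAct a k v = 0
  induction a using b_induction generalizing k with
  | zero => rw [coeffAct_zero, LinearMap.zero_apply]
  | add x y hx hy => rw [coeffAct_add, LinearMap.add_apply, hx, hy, add_zero]
  | smul c x hx => rw [coeffAct_smul, LinearMap.smul_apply, hx, smul_zero]
  | smul_X x hx =>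
    cases k with
    | zero => exact ρ.coeffAct_zero_X_smul_left x v
    | succ k => rw [coeffAct_succ_X_smul_left, hx, neg_zero]
  | gen i => exact h i k

lemma isNontrivial_iff (ρ : ConformalModule (b n) M) :
    ρ.IsNontrivial ↔ ∃ i k v, ρ.mode i k v ≠ 0 := by
  constructor
  · rintro ⟨a, v, hav⟩
    by_contra! h
    exact hav (ρ.act_eq_zero_of_mode (fun i k => h i k v) a)
  · rintro ⟨i, k, v, h⟩
    exact ⟨bL n i, v, fun h0 => h (by rw [mode, coeffAct_apply, h0, Finsupp.zero_apply])⟩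

lemma iso_of_mode (ρ : ConformalModule (b n) M) (σ : ConformalModule (b n) N)
    (e : M ≃ₗ[ℂ[X]] N) (h : ∀ i k u, e (ρ.mode i k u) = σ.mode i k (e u)) : ρ.Iso σ := by
  have hC : ∀ (c : ℂ) (u : M), e (c • u) = c • e u := fun c u => by
    rw [← C_smul_eq, map_smul, C_smul_eq]
  refine ⟨e, fun a v => Finsupp.ext fun k => ?_⟩
  rw [Finsupp.mapRange_apply]
  change σ.coeffAct a k (e v) = e (ρ.coeffAct a k v)
  induction a using b_induction generalizing k with
  | zero => simp only [coeffAct_zero, LinearMap.zero_apply, map_zero]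
  | add x y hx hy => simp only [coeffAct_add, LinearMap.add_apply, map_add, hx, hy]
  | smul c x hx => simp only [coeffAct_smul, LinearMap.smul_apply, hC, hx]
  | smul_X x hx =>
    cases k with
    | zero => simp only [coeffAct_zero_X_smul_left, map_zero]
    | succ k => simp only [coeffAct_succ_X_smul_left, map_neg, hx]
  | gen i => exact (h i k v).symm

/-- Both actions obey the same recursion when ∂ is moved past a mode, so intertwining propagates
from g to its ℂ[∂]-multiples. -/
lemma map_mode_smul (ρ : ConformalModule (b n) M) (σ : ConformalModule (b n) N)
    (e : M →ₗ[ℂ[X]] N) (g : M) (i : ℕ) (h : ∀ k, e (ρ.mode i k g) = σ.mode i k (e g))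
    (f : ℂ[X]) (k : ℕ) : e (ρ.mode i k (f • g)) = σ.mode i k (e (f • g)) := by
  induction f using Polynomial.induction_on generalizing k with
  | C c => rw [C_smul_eq, map_smul, ← C_smul_eq, map_smul, h, ← C_smul_eq, map_smul, C_smul_eq,
      C_smul_eq, map_smul]
  | add p q hp hq => rw [add_smul, map_add, map_add, hp, hq, map_add, map_add]
  | monomial m c ih =>
    have : (C c * X ^ (m + 1) : ℂ[X]) = X * (C c * X ^ m) := by ring
    rw [this, mul_smul]
    cases k with
    | zero => rw [mode_zero_X_smul, map_smul e X, ih, map_smul e X, mode_zero_X_smul]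
    | succ k => rw [mode_succ_X_smul, map_add, map_smul e X, ih, ih, map_smul e X, mode_succ_X_smul]

lemma Iso.symm {ρ : ConformalModule (b n) M} {σ : ConformalModule (b n) N} (h : ρ.Iso σ) :
    σ.Iso ρ := by
  obtain ⟨e, he⟩ := h
  refine ⟨e.symm, fun a v => ?_⟩
  have := he a (e.symm v)
  rw [e.apply_symm_apply] at this
  rw [this]
  ext k
  simp

lemma Iso.isNontrivial {ρ : ConformalModule (b n) M} {σ : ConformalModule (b n) N}
    (h : ρ.Iso σ) (hσ : σ.IsNontrivial) : ρ.IsNontrivial := by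
  obtain ⟨e, he⟩ := h
  obtain ⟨a, v, hv⟩ := hσ
  refine ⟨a, e.symm v, fun h0 => hv ?_⟩
  have := he a (e.symm v)
  rw [e.apply_symm_apply, h0] at this
  rw [this]
  simp

lemma Iso.isIrreducible {ρ : ConformalModule (b n) M} {σ : ConformalModule (b n) N}
    (h : ρ.Iso σ) (hσ : σ.IsIrreducible) : ρ.IsIrreducible := by
  obtain ⟨e, he⟩ := h
  have := hσ.1
  refine ⟨e.toEquiv.nontrivial, fun S hS => ?_⟩
  have hmap : σ.IsConformalSubmodule (S.map (e : M →ₗ[ℂ[X]] N)) := by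
    rintro a _ ⟨v, hv, rfl⟩ k
    have := DFunLike.congr_fun (he a v) k
    rw [Finsupp.mapRange_apply] at this
    exact ⟨_, hS a v hv k, this.symm⟩
  rcases hσ.2 _ hmap with h0 | h0
  · exact Or.inl (Submodule.map_eq_bot_iff.1 h0)
  · refine Or.inr (eq_top_iff.2 fun x _ => ?_)
    have hx : e x ∈ S.map (e : M →ₗ[ℂ[X]] N) := h0 ▸ Submodule.mem_top
    obtain ⟨y, hy, hxy⟩ := hx
    exact e.injective hxy ▸ hy

/-- The action on `g` is given by `L̄_0 _λ g = -n (∂ + Δ λ + α) g`, `L̄_n _λ g = β g` and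
`L̄_i _λ g = 0` for the other `i`. -/
structure HasRankOneModes (ρ : ConformalModule (b n) M) (g : M) (Δ α β : ℂ) : Prop where
  zero_zero : ρ.mode 0 0 g = (C (-(n : ℂ)) * (X + C α) : ℂ[X]) • g
  zero_one : ρ.mode 0 1 g = (C (-(n : ℂ)) * C Δ : ℂ[X]) • g
  zero_of_two_le : ∀ k, ρ.mode 0 (k + 2) g = 0
  top_zero : ρ.mode n 0 g = (C β : ℂ[X]) • g
  pos : ∀ i k, 1 ≤ i → (i ≠ n ∨ k ≠ 0) → ρ.mode i k g = 0

namespace HasRankOneModes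

variable {ρ : ConformalModule (b n) M} {g : M} {Δ α β : ℂ}

lemma eq_smul (hn : 1 ≤ n) (h : ρ.HasRankOneModes g Δ α β) (i k : ℕ) :
    ρ.mode i k g = (if i = 0 then if k = 0 then C (-(n : ℂ)) * (X + C α) else
      if k = 1 then C (-(n : ℂ)) * C Δ else 0 else
      if i = n ∧ k = 0 then C β else 0 : ℂ[X]) • g := by
  rcases Nat.eq_zero_or_pos i with rfl | hi
  · match k with
    | 0 => simpa using h.zero_zero
    | 1 => simpa using h.zero_one
    | k + 2 => simpa using h.zero_of_two_le k
  · rw [if_neg (by omega)]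
    split_ifs with hc
    · obtain ⟨rfl, rfl⟩ := hc
      exact h.top_zero
    · rw [zero_smul]
      exact h.pos i k hi (by tauto)

lemma isConformalSubmodule_span (hn : 1 ≤ n) (h : ρ.HasRankOneModes g Δ α β) :
    ρ.IsConformalSubmodule (Submodule.span ℂ[X] {g}) := by
  rw [isConformalSubmodule_iff]
  intro i k v hv
  obtain ⟨f, rfl⟩ := Submodule.mem_span_singleton.1 hv
  refine ρ.coeffAct_smul_mem _ g _ (fun k => ?_) f k
  change ρ.mode i k g ∈ _
  rw [h.eq_smul hn]
  exact Submodule.smul_mem _ _ (Submodule.mem_span_singleton_self g)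

lemma of_smul {c : ℂ} (hc : c ≠ 0) (h : ρ.HasRankOneModes (c • g) Δ α β) :
    ρ.HasRankOneModes g Δ α β := by
  have key : ∀ (i k : ℕ) (f : ℂ[X]), ρ.mode i k (c • g) = f • (c • g) → ρ.mode i k g = f • g := by
    intro i k f hf
    rw [map_smul, smul_comm] at hf
    exact smul_right_injective M hc hf
  have key0 : ∀ i k : ℕ, ρ.mode i k (c • g) = 0 → ρ.mode i k g = 0 := by
    intro i k hf
    rw [map_smul] at hf
    exact (smul_eq_zero.1 hf).resolve_left hc
  exact ⟨key _ _ _ h.zero_zero, key _ _ _ h.zero_one, fun k => key0 _ _ (h.zero_of_two_le k),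
    key _ _ _ h.top_zero, fun i k hi hk => key0 _ _ (h.pos i k hi hk)⟩

lemma isNontrivial [Module.IsTorsionFree ℂ[X] M] (hn : 1 ≤ n)
    (h : ρ.HasRankOneModes g Δ α β) (hg : g ≠ 0) : ρ.IsNontrivial := by
  rw [isNontrivial_iff]
  refine ⟨0, 0, g, ?_⟩
  rw [h.zero_zero]
  refine smul_ne_zero (mul_ne_zero ?_ (X_add_C_ne_zero α)) hg
  rw [Ne, C_eq_zero, neg_eq_zero, Nat.cast_eq_zero]
  omega

/-- Free modules of rank one with the same action on a generator are isomorphic. -/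
lemma iso [Module.IsTorsionFree ℂ[X] M] {σ : ConformalModule (b n) ℂ[X]} (hn : 1 ≤ n)
    (h : ρ.HasRankOneModes g Δ α β) (hg : g ≠ 0) (hspan : Submodule.span ℂ[X] {g} = ⊤)
    (hσ : σ.HasRankOneModes 1 Δ α β) : ρ.Iso σ := by
  let e : ℂ[X] ≃ₗ[ℂ[X]] M := LinearEquiv.ofBijective (LinearMap.toSpanSingleton ℂ[X] M g)
    ⟨smul_left_injective _ hg, fun x =>
      Submodule.mem_span_singleton.1 (hspan ▸ Submodule.mem_top)⟩
  have he : e 1 = g := one_smul _ g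
  refine Iso.symm (σ.iso_of_mode ρ e fun i k u => ?_)
  have := σ.map_mode_smul ρ e.toLinearMap 1 i (fun k => ?_) u k
  · rwa [smul_eq_mul, mul_one] at this
  · rw [LinearEquiv.coe_coe, he, h.eq_smul hn, hσ.eq_smul hn, map_smul, he]

/-- Commuting ∂ past L_{0,1} leaves L_{0,0} g = -n(∂ + α)g, which is exactly the term with Δ = 1 on
the new generator. -/
lemma shift (hn : 1 ≤ n) (h : ρ.HasRankOneModes g 0 α 0) :
    ρ.HasRankOneModes ((X + C α : ℂ[X]) • g) 1 α 0 := by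
  have e : (X + C α : ℂ[X]) • g = (X : ℂ[X]) • g + α • g := by rw [add_smul, C_smul_eq]
  have key0 : ∀ i, ρ.mode i 0 ((X + C α : ℂ[X]) • g) = (X + C α : ℂ[X]) • ρ.mode i 0 g := by
    intro i
    rw [e, map_add, mode_zero_X_smul, map_smul, add_smul, C_smul_eq]
  have key : ∀ i k, ρ.mode i (k + 1) ((X + C α : ℂ[X]) • g) =
      (X + C α : ℂ[X]) • ρ.mode i (k + 1) g + ρ.mode i k g := by
    intro i k
    rw [e, map_add, mode_succ_X_smul, map_smul, add_smul, C_smul_eq]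
    abel
  have h1 : ρ.mode 0 1 g = 0 := by rw [h.zero_one, C_0, mul_zero, zero_smul]
  have h2 : ∀ i k, 1 ≤ i → ρ.mode i k g = 0 := by
    intro i k hi
    by_cases hik : i = n ∧ k = 0
    · rw [hik.1, hik.2, h.top_zero, C_0, zero_smul]
    · exact h.pos i k hi (by tauto)
  refine ⟨?_, ?_, fun k => ?_, ?_, fun i k hi _ => ?_⟩
  · rw [key0, h.zero_zero, smul_comm]
  · rw [key, h1, smul_zero, zero_add, h.zero_zero, smul_smul]
    simp
  · rw [key, h.zero_of_two_le, smul_zero, zero_add]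
    cases k with
    | zero => exact h1
    | succ k => exact h.zero_of_two_le k
  · rw [key0, h2 n 0 hn, smul_zero, C_0, zero_smul]
  · cases k with
    | zero => rw [key0, h2 i 0 hi, smul_zero]
    | succ k => rw [key, h2 i _ hi, h2 i _ hi, smul_zero, add_zero]

end HasRankOneModes

/-- The submodule of vectors killed by the action of `L̄_i` for all `i` in `s`. -/
def killedBy (ρ : ConformalModule (b n) M) (s : Set ℕ) : Submodule ℂ[X] M where
  carrier := {u | ∀ i ∈ s, ∀ k, ρ.mode i k u = 0}
  add_mem' hu hv i hi k := by rw [map_add, hu i hi k, hv i hi k, add_zero]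
  zero_mem' i _ k := map_zero _
  smul_mem' f u hu i hi k := ρ.coeffAct_smul_mem (bL n i) u ⊥ (fun k => hu i hi k) f k

/-- Each property holds because a suitable kernel is a conformal submodule. For L̄_m this works
since [L̄_0, L̄_m] is proportional to L̄_m and the L̄_i with i ≥ 1 commute with it by assumption. -/
lemma IsIrreducible.isSchur {ρ : ConformalModule (b n) M} (h : ρ.IsIrreducible)
    (h' : ρ.IsNontrivial) : ρ.IsSchur where
  eq_zero_of_trivial u hu := by
    have hT : ρ.IsConformalSubmodule (ρ.killedBy Set.univ) := by
      rw [isConformalSubmodule_iff]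
      intro i k v hv
      rw [hv i trivial k]
      exact Submodule.zero_mem _
    rcases h.2 _ hT with h0 | h0
    · have : u ∈ ρ.killedBy Set.univ := fun i _ k => hu i k
      rwa [h0, Submodule.mem_bot] at this
    · obtain ⟨i, k, v, hv⟩ := ρ.isNontrivial_iff.1 h'
      have : v ∈ ρ.killedBy Set.univ := h0 ▸ Submodule.mem_top
      exact absurd (this i trivial k) hv
  endo_eq_zero T hT hu := by
    obtain ⟨u, hu0, hu⟩ := hu
    have hK : ρ.IsConformalSubmodule (LinearMap.ker T) := by
      rw [isConformalSubmodule_iff]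
      intro i k v hv
      rw [LinearMap.mem_ker] at hv ⊢
      rw [hT, hv, map_zero]
    rcases h.2 _ hK with h0 | h0
    · exact absurd (LinearMap.ker_eq_bot'.1 h0 u hu) hu0
    · exact LinearMap.ker_eq_top.1 h0
  mode_eq_zero m hm hu k := by
    obtain ⟨u, hu0, hu⟩ := hu
    have hK : ρ.IsConformalSubmodule (ρ.killedBy {m}) := by
      rw [isConformalSubmodule_iff]
      rintro i s v hv j rfl k
      have hv' := hv j rfl
      rcases Nat.eq_zero_or_pos i with rfl | hi
      · have := ρ.commutator_mode 0 j s k v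
        simpa [hv'] using this
      · rw [← ρ.mode_comm (hm i hi), hv', map_zero]
    have hmem : u ∈ ρ.killedBy {m} := by
      rintro j rfl k
      exact hu k
    rcases h.2 _ hK with h0 | h0
    · rw [h0, Submodule.mem_bot] at hmem
      exact absurd hmem hu0
    · ext v
      have : v ∈ ρ.killedBy {m} := h0 ▸ Submodule.mem_top
      exact this m rfl k

/-- If a acts nontrivially on u, it does so on f(∂)u for f ≠ 0; hence torsion vectors are killed by
everything. -/
lemma IsSchur.isTorsionFree {ρ : ConformalModule (b n) M} (hρ : ρ.IsSchur) :
    Module.IsTorsionFree ℂ[X] M := by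
  refine Module.isTorsionFree_iff_smul_eq_zero.2 fun f u hfu => ?_
  by_contra! hc
  refine hc.2 (hρ.eq_zero_of_trivial u fun i k => ?_)
  by_contra hne
  obtain ⟨j, -, hj⟩ := ρ.exists_coeffAct_smul_ne_zero (bL n i) u hne hc.1
  exact hj (by rw [hfu, map_zero])

/-- Anything that kills a nonzero multiple f(∂)g already kills g, by the degree shift or by
torsion-freeness, and therefore the whole module. -/
lemma isSchur_of_generator [Module.IsTorsionFree ℂ[X] M] {ρ : ConformalModule (b n) M}
    (h : ρ.IsNontrivial) {g : M} (hspan : Submodule.span ℂ[X] {g} = ⊤) : ρ.IsSchur := by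
  have hgen : ∀ u : M, ∃ f : ℂ[X], f • g = u := fun u =>
    Submodule.mem_span_singleton.1 (hspan ▸ Submodule.mem_top)
  have hkill : ∀ i, (∀ k, ρ.mode i k g = 0) → ∀ u k, ρ.mode i k u = 0 := by
    intro i hi u k
    obtain ⟨f, rfl⟩ := hgen u
    exact ρ.coeffAct_smul_mem (bL n i) g ⊥ hi f k
  have hdiv : ∀ i u, u ≠ 0 → (∀ k, ρ.mode i k u = 0) → ∀ k, ρ.mode i k g = 0 := by
    intro i u hu0 hu k
    obtain ⟨f, rfl⟩ := hgen u
    by_contra hne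
    obtain ⟨j, -, hj⟩ := ρ.exists_coeffAct_smul_ne_zero (bL n i) g hne
      (fun h0 : f = 0 => hu0 (by rw [h0, zero_smul]))
    exact hj (hu j)
  refine ⟨fun u hu => ?_, fun T hT hu => ?_, fun m _ hu k => ?_⟩
  · by_contra hu0
    obtain ⟨i, k, v, hv⟩ := ρ.isNontrivial_iff.1 h
    exact hv (hkill i (hdiv i u hu0 (hu i)) v k)
  · obtain ⟨u, hu0, hu⟩ := hu
    obtain ⟨f, rfl⟩ := hgen u
    rw [map_smul] at hu
    have hg : T g = 0 := (smul_eq_zero.1 hu).resolve_left fun h0 : f = 0 => hu0 (by rw [h0, zero_smul])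
    ext v
    obtain ⟨f, rfl⟩ := hgen v
    rw [map_smul, hg, smul_zero, LinearMap.zero_apply]
  · obtain ⟨u, hu0, hu⟩ := hu
    ext v
    exact hkill m (hdiv m u hu0 hu) v k

/-- A nontrivial finite module which is irreducible or free of rank one has a vector spanning a
submodule of the form `M_{Δ,α}` or `M_{Δ,α,β}`. -/
lemma IsSchur.exists_hasRankOneModes [Module.Finite ℂ[X] M] [Module.IsTorsionFree ℂ[X] M]
    [Nontrivial M] {ρ : ConformalModule (b n) M} (hρ : ρ.IsSchur) (hn : 1 ≤ n) :
    ∃ (v : M) (Δ α β : ℂ), v ≠ 0 ∧ ρ.HasRankOneModes v Δ α β ∧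
      ∀ u, ρ.mode 0 0 u = (C (-(n : ℂ)) * (X + C α) : ℂ[X]) • u := by
  obtain ⟨α, hα⟩ := hρ.exists_mode_zero_zero hn
  obtain ⟨β, hβ⟩ := hρ.exists_mode_top_zero
  obtain ⟨c, v, hv0, hc, h2, hv⟩ := hρ.exists_highest_vector hn
  have hn0 : (n : ℂ) ≠ 0 := Nat.cast_ne_zero.2 (by omega)
  -- The eigenvalue c of L_{0,1} is to be -nΔ.
  refine ⟨v, -c / n, α, β, hv0, ⟨hα v, ?_, fun k => h2 _ (by omega), ?_, ?_⟩, hα⟩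
  · rw [hc, ← C_mul, C_smul_eq]
    congr 1
    field_simp
  · rw [hβ, C_smul_eq]
  · intro i k hi hik
    cases k with
    | succ k => exact hv i hi k
    | zero =>
      rcases lt_trichotomy i n with h | h | h
      · rw [hρ.mode_eq_zero_of_pos (by omega) hi, LinearMap.zero_apply]
      · simp [h] at hik
      · rw [ρ.mode_eq_zero_of_lt h, LinearMap.zero_apply]

lemma IsSchur.eq_zero_of_one_lt [Module.Finite ℂ[X] M] [Module.IsTorsionFree ℂ[X] M]
    [Nontrivial M] {ρ : ConformalModule (b n) M} (hρ : ρ.IsSchur) (hn : 1 < n) {g : M}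
    (hg : g ≠ 0) {Δ α β : ℂ} (h : ρ.HasRankOneModes g Δ α β) : β = 0 := by
  have := h.top_zero
  rw [hρ.mode_eq_zero_of_pos hn hn.le, LinearMap.zero_apply, eq_comm, smul_eq_zero] at this
  exact C_eq_zero.1 (this.resolve_right hg)

lemma IsSchur.exists_hasRankOneModes_generator [Module.Finite ℂ[X] M]
    [Module.IsTorsionFree ℂ[X] M] [Nontrivial M] {ρ : ConformalModule (b n) M} (hρ : ρ.IsSchur)
    (hn : 1 ≤ n) {g : M} (hspan : Submodule.span ℂ[X] {g} = ⊤) :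
    ∃ Δ α β : ℂ, ρ.HasRankOneModes g Δ α β := by
  obtain ⟨v, Δ, α, β, hv0, hv, hα⟩ := hρ.exists_hasRankOneModes hn
  obtain ⟨f, rfl⟩ : ∃ f : ℂ[X], f • g = v :=
    Submodule.mem_span_singleton.1 (hspan ▸ Submodule.mem_top)
  have hf0 : f ≠ 0 := fun h => hv0 (by rw [h, zero_smul])
  rcases Nat.eq_zero_or_pos f.natDegree with hd | hd
  · rw [eq_C_of_natDegree_eq_zero hd] at hv hf0
    rw [C_smul_eq] at hv
    exact ⟨Δ, α, β, hv.of_smul fun h => hf0 (by rw [h, C_0])⟩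
  · have key : ∀ i k, (∀ j, k < j → ρ.mode i j (f • g) = 0) → ρ.mode i k g = 0 := by
      intro i k h
      by_contra hne
      obtain ⟨j, hj, hj'⟩ := ρ.exists_coeffAct_smul_ne_zero (bL n i) g hne hf0
      exact hj' (h j (by omega))
    have h0 : ∀ k, ρ.mode 0 (k + 1) g = 0 := fun k => key 0 (k + 1) fun j hj => by
      obtain ⟨j, rfl⟩ : ∃ i, j = i + 2 := ⟨j - 2, by omega⟩
      exact hv.zero_of_two_le j
    have h1 : ∀ i k, 1 ≤ i → ρ.mode i k g = 0 := fun i k hi => key i k fun j hj =>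
      hv.pos i j hi (Or.inr (by omega))
    refine ⟨0, α, 0, hα g, ?_, fun k => h0 (k + 1), ?_, fun i k hi _ => h1 i k hi⟩
    · rw [h0, C_0, mul_zero, zero_smul]
    · rw [h1 n 0 hn, C_0, zero_smul]

end ConformalModule

end Generators

/-! ### Submodules of the rank one models -/

section RankOne

lemma mem_shiftSubmodule {α : ℂ} {p : ℂ[X]} : p ∈ shiftSubmodule α ↔ X + C α ∣ p := by
  simp only [shiftSubmodule, Submodule.mem_map, Submodule.mem_top, true_and, LinearMap.lsmul_apply,
    smul_eq_mul, dvd_def]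
  exact exists_congr fun q => eq_comm

lemma shiftSubmodule_eq_span (α : ℂ) :
    shiftSubmodule α = Submodule.span ℂ[X] {(X + C α : ℂ[X])} := by
  ext p
  rw [mem_shiftSubmodule]
  exact Ideal.mem_span_singleton.symm

lemma shiftSubmodule_ne_bot (α : ℂ) : shiftSubmodule α ≠ ⊥ :=
  (Submodule.ne_bot_iff _).2 ⟨X + C α, mem_shiftSubmodule.2 dvd_rfl, X_add_C_ne_zero α⟩

lemma shiftSubmodule_ne_top (α : ℂ) : shiftSubmodule α ≠ ⊤ := by
  intro h
  have : (1 : ℂ[X]) ∈ shiftSubmodule α := h ▸ Submodule.mem_top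
  have h1 := (isUnit_of_dvd_one (mem_shiftSubmodule.1 this))
  exact not_isUnit_X_add_C α h1

lemma eq_top_of_C_mem {S : Submodule ℂ[X] ℂ[X]} {c : ℂ} (hc : c ≠ 0) (h : C c ∈ S) : S = ⊤ :=
  Ideal.eq_top_of_isUnit_mem S h (isUnit_C.2 hc.isUnit)

/-- The ideal generated by ∂ + α is maximal: any other element is congruent to its nonzero value at
-α. -/
lemma eq_shiftSubmodule_or_eq_top {α : ℂ} {S : Submodule ℂ[X] ℂ[X]} (h : X + C α ∈ S) :
    S = shiftSubmodule α ∨ S = ⊤ := by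
  have hle : shiftSubmodule α ≤ S := by
    rw [shiftSubmodule_eq_span, Submodule.span_singleton_le_iff_mem]
    exact h
  by_cases hS : S ≤ shiftSubmodule α
  · exact Or.inl (le_antisymm hS hle)
  · right
    obtain ⟨p, hp, hp'⟩ := Set.not_subset.1 hS
    have e : (X + C α : ℂ[X]) = X - C (-α) := by rw [C_neg, sub_neg_eq_add]
    have hr : p.eval (-α) ≠ 0 := fun h0 => hp' <| mem_shiftSubmodule.2 <| by
      rw [e]; exact dvd_iff_isRoot.2 h0
    refine eq_top_of_C_mem hr ?_
    have hd : p - C (p.eval (-α)) ∈ S := hle <| mem_shiftSubmodule.2 <| by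
      rw [e]; exact X_sub_C_dvd_sub_C_eval
    simpa using S.sub_mem hp hd

namespace ConformalModule

variable {n : ℕ} {σ : ConformalModule (b n) ℂ[X]} {Δ α β : ℂ}

/-- A nonzero submodule of `M_{Δ,α}` or `M_{Δ,α,β}` contains `(∂ + α) v`, and it is everything
unless `Δ = β = 0`. -/
lemma HasRankOneModes.eq_top_or_mem (hn : 1 ≤ n) (h : σ.HasRankOneModes 1 Δ α β)
    {S : Submodule ℂ[X] ℂ[X]} (hS : σ.IsConformalSubmodule S) (hS0 : S ≠ ⊥) :
    S = ⊤ ∨ Δ = 0 ∧ β = 0 ∧ X + C α ∈ S := by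
  obtain ⟨f, hf, hf0⟩ := (Submodule.ne_bot_iff _).1 hS0
  have hl : f.leadingCoeff ≠ 0 := leadingCoeff_ne_zero.2 hf0
  have hn0 : (n : ℂ) ≠ 0 := Nat.cast_ne_zero.2 (by omega)
  rw [isConformalSubmodule_iff] at hS
  -- The coefficient of λ^(k + deg f) in L̄_i acting on f sees only the leading coefficient of f.
  -- This yields a nonzero constant from Δ or β, and otherwise a multiple of ∂ + α.
  have key : ∀ i k, (∀ j, k < j → σ.mode i j 1 = 0) → f.leadingCoeff • σ.mode i k 1 ∈ S := by
    intro i k hik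
    have h1 := (σ.coeffAct_smul_of_natDegree_le (bL n i) 1 k hik f.natDegree f le_rfl).2
    rw [smul_eq_mul, mul_one, coeff_natDegree] at h1
    exact h1 ▸ hS i _ f hf
  by_cases hΔ : Δ = 0
  · by_cases hβ : β = 0
    · refine Or.inr ⟨hΔ, hβ, ?_⟩
      have h1 := key 0 0 (fun j hj => by
        match j, hj with
        | 1, _ => rw [h.zero_one, hΔ, C_0, mul_zero, zero_smul]
        | j + 2, _ => exact h.zero_of_two_le j)
      rw [h.zero_zero, ← C_smul_eq, smul_smul, smul_eq_mul, mul_one, ← mul_assoc, ← C_mul] at h1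
      refine (Ideal.unit_mul_mem_iff_mem S (isUnit_C.2 (IsUnit.mk0 _ ?_))).1 h1
      exact mul_ne_zero hl (neg_ne_zero.2 hn0)
    · left
      have h1 := key n 0 (fun j hj => h.pos n j hn (Or.inr (by omega)))
      rw [h.top_zero, ← C_smul_eq, smul_smul, smul_eq_mul, mul_one, ← C_mul] at h1
      exact eq_top_of_C_mem (mul_ne_zero hl hβ) h1
  · left
    have h1 := key 0 1 (fun j hj => by
      obtain ⟨j, rfl⟩ : ∃ i, j = i + 2 := ⟨j - 2, by omega⟩
      exact h.zero_of_two_le j)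
    rw [h.zero_one, ← C_smul_eq, smul_smul, smul_eq_mul, mul_one, ← C_mul, ← C_mul] at h1
    exact eq_top_of_C_mem (mul_ne_zero hl (mul_ne_zero (neg_ne_zero.2 hn0) hΔ)) h1

lemma HasRankOneModes.isConformalSubmodule_shift (hn : 1 ≤ n) (h : σ.HasRankOneModes 1 0 α 0) :
    σ.IsConformalSubmodule (shiftSubmodule α) := by
  have := (h.shift hn).isConformalSubmodule_span hn
  rwa [smul_eq_mul, mul_one, ← shiftSubmodule_eq_span] at this

lemma HasRankOneModes.isIrreducible_iff (hn : 1 ≤ n) (h : σ.HasRankOneModes 1 Δ α β) :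
    σ.IsIrreducible ↔ Δ ≠ 0 ∨ β ≠ 0 := by
  constructor
  · intro hirr
    by_contra! hc
    obtain ⟨rfl, rfl⟩ := hc
    exact (hirr.2 _ (h.isConformalSubmodule_shift hn)).elim (shiftSubmodule_ne_bot α)
      (shiftSubmodule_ne_top α)
  · intro hc
    refine ⟨inferInstance, fun S hS => or_iff_not_imp_left.2 fun hS0 => ?_⟩
    refine (h.eq_top_or_mem hn hS hS0).resolve_right ?_
    rintro ⟨h1, h2, -⟩
    tauto

lemma HasRankOneModes.isConformalSubmodule_proper_iff (hn : 1 ≤ n)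
    (h : σ.HasRankOneModes 1 0 α 0) (S : Submodule ℂ[X] ℂ[X]) :
    (σ.IsConformalSubmodule S ∧ S ≠ ⊥ ∧ S ≠ ⊤) ↔ S = shiftSubmodule α := by
  constructor
  · rintro ⟨hS, h0, h1⟩
    exact (eq_shiftSubmodule_or_eq_top
      ((h.eq_top_or_mem hn hS h0).resolve_left h1).2.2).resolve_right h1
  · rintro rfl
    exact ⟨h.isConformalSubmodule_shift hn, shiftSubmodule_ne_bot α, shiftSubmodule_ne_top α⟩

lemma HasRankOneModes.restrict_shift (hn : 1 ≤ n) (h : σ.HasRankOneModes 1 0 α 0)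
    {τ : ConformalModule (b n) ℂ[X]} (hτ : τ.HasRankOneModes 1 1 α 0)
    (hS : σ.IsConformalSubmodule (shiftSubmodule α)) :
    (σ.restrict (shiftSubmodule α) hS).Iso τ := by
  have hs := h.shift hn
  rw [smul_eq_mul, mul_one] at hs
  let g : shiftSubmodule α := ⟨X + C α, mem_shiftSubmodule.2 dvd_rfl⟩
  have hg : (σ.restrict (shiftSubmodule α) hS).HasRankOneModes g 1 α 0 :=
    ⟨Subtype.ext hs.zero_zero, Subtype.ext hs.zero_one, fun k => Subtype.ext (hs.zero_of_two_le k),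
      Subtype.ext hs.top_zero, fun i k hi hk => Subtype.ext (hs.pos i k hi hk)⟩
  refine hg.iso hn (fun h0 => X_add_C_ne_zero α (congrArg Subtype.val h0)) ?_ hτ
  refine eq_top_iff.2 fun x _ => Submodule.mem_span_singleton.2 ?_
  obtain ⟨q, hq⟩ := mem_shiftSubmodule.1 x.2
  exact ⟨q, Subtype.ext (by rw [hq, mul_comm]; rfl)⟩

end ConformalModule

lemma act_bM (n i : ℕ) (Δ α : ℂ) : (bM n Δ α).act (bL n i) 1 =
    if i = 0 then Finsupp.single 0 (C (-(n : ℂ)) * (X + C α)) +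
      Finsupp.single 1 (C (-(n : ℂ)) * C Δ) else 0 := by
  refine lamPoly_ext fun l => ?_
  rw [lamEval_bM_act]
  split_ifs
  · rw [map_add, lamEval_single, lamEval_single, smul_eq_mul, smul_eq_mul]
    ring
  · rw [map_zero]

lemma act_bMβ (i : ℕ) (Δ α β : ℂ) : (bMβ Δ α β).act (bL 1 i) 1 =
    if i = 0 then Finsupp.single 0 (-(X + C α)) + Finsupp.single 1 (-C Δ) else
      if i = 1 then Finsupp.single 0 (C β) else 0 := by
  refine lamPoly_ext fun l => ?_
  rw [lamEval_bMβ_act]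
  split_ifs
  · rw [map_add, lamEval_single, lamEval_single, smul_eq_mul, smul_eq_mul]
    ring
  · rw [lamEval_single, pow_zero, one_smul]
  · rw [map_zero]

lemma bM_hasRankOneModes {n : ℕ} (hn : 1 ≤ n) (Δ α : ℂ) :
    (bM n Δ α).HasRankOneModes 1 Δ α 0 := by
  have hm : ∀ i k, (bM n Δ α).mode i k 1 = (bM n Δ α).act (bL n i) 1 k := fun _ _ => rfl
  refine ⟨?_, ?_, fun k => ?_, ?_, fun i k hi _ => ?_⟩
  · simp [hm, act_bM]
  · simp [hm, act_bM]
  · simp [hm, act_bM]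
  · rw [hm, act_bM, if_neg (by omega)]
    simp
  · rw [hm, act_bM, if_neg (by omega), Finsupp.zero_apply]

lemma bMβ_hasRankOneModes (Δ α β : ℂ) : (bMβ Δ α β).HasRankOneModes 1 Δ α β := by
  have hm : ∀ i k, (bMβ Δ α β).mode i k 1 = (bMβ Δ α β).act (bL 1 i) 1 k := fun _ _ => rfl
  refine ⟨?_, ?_, fun k => ?_, ?_, fun i k hi hik => ?_⟩
  · simp [hm, act_bMβ]
  · simp [hm, act_bMβ]
  · simp [hm, act_bMβ]
  · simp [hm, act_bMβ]
  · rw [hm, act_bMβ, if_neg (by omega)]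
    split_ifs with h1
    · exact Finsupp.single_eq_of_ne (by tauto)
    · rfl

end RankOne

/-! ### Classification of both types of modules -/

section Classification

variable {M : Type v} [AddCommGroup M] [Module ℂ M] [Module ℂ[X] M] [IsScalarTower ℂ ℂ[X] M]

namespace ConformalModule

variable {n : ℕ}

/-- A nontrivial free module of rank one is determined by its parameters. -/
lemma exists_parameters_of_rank_one (hn : 1 ≤ n) (ρ : ConformalModule (b n) M)
    [Module.Free ℂ[X] M] (hr : Module.rank ℂ[X] M = 1) (h : ρ.IsNontrivial) :
    ∃ Δ α β : ℂ, (1 < n → β = 0) ∧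
      ∀ σ : ConformalModule (b n) ℂ[X], σ.HasRankOneModes 1 Δ α β → ρ.Iso σ := by
  obtain ⟨e⟩ := Module.nonempty_linearEquiv_iff_rank_eq_one.2 hr
  have hg : e 1 ≠ 0 := fun h0 => one_ne_zero (e.map_eq_zero_iff.1 h0)
  have hspan : Submodule.span ℂ[X] {e 1} = ⊤ := by
    refine eq_top_iff.2 fun x _ => Submodule.mem_span_singleton.2 ⟨e.symm x, ?_⟩
    rw [← map_smul, smul_eq_mul, mul_one, e.apply_symm_apply]
  have := Module.Finite.equiv e
  have : Module.IsTorsionFree ℂ[X] M :=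
    e.symm.injective.moduleIsTorsionFree _ (fun r m => map_smul e.symm r m)
  have : Nontrivial M := ⟨_, _, hg⟩
  have hρ : ρ.IsSchur := isSchur_of_generator h hspan
  obtain ⟨Δ, α, β, hm⟩ := hρ.exists_hasRankOneModes_generator hn hspan
  exact ⟨Δ, α, β, fun h1 => hρ.eq_zero_of_one_lt h1 hg hm, fun σ hσ => hm.iso hn hg hspan hσ⟩

/-- A nontrivial finite irreducible module is free of rank one, and determined by its
parameters. -/
lemma exists_parameters_of_isIrreducible (hn : 1 ≤ n) (ρ : ConformalModule (b n) M)
    [Module.Finite ℂ[X] M] (hirr : ρ.IsIrreducible) (h : ρ.IsNontrivial) :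
    ∃ Δ α β : ℂ, (1 < n → β = 0) ∧
      ∀ σ : ConformalModule (b n) ℂ[X], σ.HasRankOneModes 1 Δ α β → ρ.Iso σ := by
  have hρ := hirr.isSchur h
  have := hρ.isTorsionFree
  have := hirr.1
  obtain ⟨v, Δ, α, β, hv0, hm, -⟩ := hρ.exists_hasRankOneModes hn
  have hspan : Submodule.span ℂ[X] {v} = ⊤ :=
    (hirr.2 _ (hm.isConformalSubmodule_span hn)).resolve_left fun h0 =>
      hv0 (Submodule.span_singleton_eq_bot.1 h0)
  exact ⟨Δ, α, β, fun h1 => hρ.eq_zero_of_one_lt h1 hv0 hm, fun σ hσ => hm.iso hn hv0 hspan hσ⟩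

lemma Iso.free_rank_one_nontrivial (hn : 1 ≤ n) {ρ : ConformalModule (b n) M}
    {σ : ConformalModule (b n) ℂ[X]} (h : ρ.Iso σ) {Δ α β : ℂ} (hσ : σ.HasRankOneModes 1 Δ α β) :
    Module.Free ℂ[X] M ∧ Module.rank ℂ[X] M = 1 ∧ ρ.IsNontrivial := by
  have ht := h.isNontrivial (hσ.isNontrivial hn one_ne_zero)
  obtain ⟨e, -⟩ := h
  have hfree := Module.Free.of_equiv e.symm
  exact ⟨hfree, Module.nonempty_linearEquiv_iff_rank_eq_one.1 ⟨e.symm⟩, ht⟩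

lemma Iso.finite_irreducible_nontrivial (hn : 1 ≤ n) {ρ : ConformalModule (b n) M}
    {σ : ConformalModule (b n) ℂ[X]} (h : ρ.Iso σ) {Δ α β : ℂ} (hσ : σ.HasRankOneModes 1 Δ α β)
    (hne : Δ ≠ 0 ∨ β ≠ 0) : Module.Finite ℂ[X] M ∧ ρ.IsIrreducible ∧ ρ.IsNontrivial := by
  refine ⟨?_, h.isIrreducible ((hσ.isIrreducible_iff hn).2 hne),
    h.isNontrivial (hσ.isNontrivial hn one_ne_zero)⟩
  obtain ⟨e, -⟩ := h
  exact Module.Finite.equiv e.symm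

end ConformalModule

end Classification

end LieConf

end

/-! ### The theorem -/

open LieConf

theorem corollary5p3 :
    -- nontrivial free modules of rank one
    (∀ n : ℕ, 1 < n → ∀ (M : Type*) [AddCommGroup M] [Module ℂ M] [Module ℂ[X] M]
        [IsScalarTower ℂ ℂ[X] M] (ρ : ConformalModule (b n) M),
      (Module.Free ℂ[X] M ∧ Module.rank ℂ[X] M = 1 ∧ ρ.IsNontrivial) ↔
        ∃ Δ α : ℂ, ρ.Iso (bM n Δ α)) ∧
    (∀ (M : Type*) [AddCommGroup M] [Module ℂ M] [Module ℂ[X] M]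
        [IsScalarTower ℂ ℂ[X] M] (ρ : ConformalModule (b 1) M),
      (Module.Free ℂ[X] M ∧ Module.rank ℂ[X] M = 1 ∧ ρ.IsNontrivial) ↔
        ∃ Δ α β : ℂ, ρ.Iso (bMβ Δ α β)) ∧
    -- irreducibility
    (∀ n : ℕ, 1 ≤ n → ∀ Δ α : ℂ, (bM n Δ α).IsIrreducible ↔ Δ ≠ 0) ∧
    (∀ Δ α β : ℂ, (bMβ Δ α β).IsIrreducible ↔ Δ ≠ 0 ∨ β ≠ 0) ∧
    -- submodules of the reducible modules
    (∀ n : ℕ, 1 ≤ n → ∀ α : ℂ,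
      (∀ S : Submodule ℂ[X] ℂ[X],
        ((bM n 0 α).IsConformalSubmodule S ∧ S ≠ ⊥ ∧ S ≠ ⊤) ↔ S = shiftSubmodule α) ∧
      ∃ h : (bM n 0 α).IsConformalSubmodule (shiftSubmodule α),
        ((bM n 0 α).restrict (shiftSubmodule α) h).Iso (bM n 1 α)) ∧
    (∀ α : ℂ,
      (∀ S : Submodule ℂ[X] ℂ[X],
        ((bMβ 0 α 0).IsConformalSubmodule S ∧ S ≠ ⊥ ∧ S ≠ ⊤) ↔ S = shiftSubmodule α) ∧
      ∃ h : (bMβ 0 α 0).IsConformalSubmodule (shiftSubmodule α),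
        ((bMβ 0 α 0).restrict (shiftSubmodule α) h).Iso (bMβ 1 α 0)) ∧
    -- nontrivial finite irreducible modules
    (∀ n : ℕ, 1 < n → ∀ (M : Type*) [AddCommGroup M] [Module ℂ M] [Module ℂ[X] M]
        [IsScalarTower ℂ ℂ[X] M] (ρ : ConformalModule (b n) M),
      (Module.Finite ℂ[X] M ∧ ρ.IsIrreducible ∧ ρ.IsNontrivial) ↔
        ∃ Δ α : ℂ, Δ ≠ 0 ∧ ρ.Iso (bM n Δ α)) ∧
    (∀ (M : Type*) [AddCommGroup M] [Module ℂ M] [Module ℂ[X] M]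
        [IsScalarTower ℂ ℂ[X] M] (ρ : ConformalModule (b 1) M),
      (Module.Finite ℂ[X] M ∧ ρ.IsIrreducible ∧ ρ.IsNontrivial) ↔
        ∃ Δ α β : ℂ, (Δ ≠ 0 ∨ β ≠ 0) ∧ ρ.Iso (bMβ Δ α β)) := by
  refine ⟨fun n hn M _ _ _ _ ρ => ⟨?_, ?_⟩, fun M _ _ _ _ ρ => ⟨?_, ?_⟩, fun n hn Δ α => ?_,
    fun Δ α β => (bMβ_hasRankOneModes Δ α β).isIrreducible_iff le_rfl, fun n hn α => ?_,
    fun α => ?_, fun n hn M _ _ _ _ ρ => ⟨?_, ?_⟩, fun M _ _ _ _ ρ => ⟨?_, ?_⟩⟩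
  · rintro ⟨hfree, hr, ht⟩
    obtain ⟨Δ, α, β, hβ, h⟩ := ρ.exists_parameters_of_rank_one hn.le hr ht
    obtain rfl := hβ hn
    exact ⟨Δ, α, h _ (bM_hasRankOneModes hn.le Δ α)⟩
  · rintro ⟨Δ, α, h⟩
    exact h.free_rank_one_nontrivial hn.le (bM_hasRankOneModes hn.le Δ α)
  · rintro ⟨hfree, hr, ht⟩
    obtain ⟨Δ, α, β, -, h⟩ := ρ.exists_parameters_of_rank_one le_rfl hr ht
    exact ⟨Δ, α, β, h _ (bMβ_hasRankOneModes Δ α β)⟩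
  · rintro ⟨Δ, α, β, h⟩
    exact h.free_rank_one_nontrivial le_rfl (bMβ_hasRankOneModes Δ α β)
  · rw [(bM_hasRankOneModes hn Δ α).isIrreducible_iff hn]
    simp
  · have h := bM_hasRankOneModes hn 0 α
    exact ⟨h.isConformalSubmodule_proper_iff hn, h.isConformalSubmodule_shift hn,
      h.restrict_shift hn (bM_hasRankOneModes hn 1 α) _⟩
  · have h := bMβ_hasRankOneModes 0 α 0
    exact ⟨h.isConformalSubmodule_proper_iff le_rfl, h.isConformalSubmodule_shift le_rfl,
      h.restrict_shift le_rfl (bMβ_hasRankOneModes 1 α 0) _⟩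
  · rintro ⟨hf, hirr, ht⟩
    obtain ⟨Δ, α, β, hβ, h⟩ := ρ.exists_parameters_of_isIrreducible hn.le hirr ht
    obtain rfl := hβ hn
    have hσ := bM_hasRankOneModes hn.le Δ α
    -- The classification leaves Δ unrestricted; irreducibility carried over to the model excludes Δ
    -- = 0.
    have hne := (hσ.isIrreducible_iff hn.le).1 ((h _ hσ).symm.isIrreducible hirr)
    exact ⟨Δ, α, hne.resolve_right (not_not.2 rfl), h _ hσ⟩
  · rintro ⟨Δ, α, hΔ, h⟩
    exact h.finite_irreducible_nontrivial hn.le (bM_hasRankOneModes hn.le Δ α) (Or.inl hΔ)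
  · rintro ⟨hf, hirr, ht⟩
    obtain ⟨Δ, α, β, -, h⟩ := ρ.exists_parameters_of_isIrreducible le_rfl hirr ht
    have hσ := bMβ_hasRankOneModes Δ α β
    exact ⟨Δ, α, β, (hσ.isIrreducible_iff le_rfl).1 ((h _ hσ).symm.isIrreducible hirr), h _ hσ⟩
  · rintro ⟨Δ, α, β, hne, h⟩
    exact h.finite_irreducible_nontrivial le_rfl (bMβ_hasRankOneModes Δ α β) hne
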